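/- **Definitions.** The rudimentary functions are the functions from $n$-tuples of sets to sets ($n\ge 1$) generated from $F(x_1,\dots,x_n)=x_i$, $F(x_1,\dots,x_n)=\{x_i,x_j\}$ and $F(x_1,\dots,x_n)=x_i\setminus x_j$ by composition and by the scheme $F(x_1,\dots,x_n)=\bigcup_{y\in x_1}H(y,x_2,\dots,x_n)$. The rudimentary closure of a set $x$ is the smallest set $y$ with $x\subseteq y$ and $x\in y$ that is closed under all rudimentary functions. Let $J_1$ be the rudimentary closure of $\emptyset$ and $J_2$ the rudimentary closure of $J_1$. An *$\iota$-set* is an element of $J_2$, and an *$\iota$-subset* of $X$ is an $\iota$-set included in $X$. An *$\iota$-class* is a subset of $J_2$ that is first-order definable over $(J_2,\in)$ with parameters from $J_2$ and whose intersection with every $\iota$-set is an $\iota$-set. An *$\iota$-relation* on an $\iota$-class $X$ is an $\iota$-class included in $X\times X$ (with Kuratowski pairs). An *$\iota$-function* from an $\iota$-class $X$ to an $\iota$-class $Y$ is a function $F:X\to Y$ whose graph is an $\iota$-class and such that for each $\iota$-subset $x$ of $X$ the image $F[x]$ is included in an $\iota$-set. Natural numbers are von Neumann numbers, integers are blocks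 of pairs of natural numbers, and rational numbers are blocks of pairs of integers with nonzero second component, as usual; $\mathbf Q$ is the resulting set. Let $\mathbf R_\iota$ be the set of all Dedekind $\iota$-cuts, i.e. of all $\iota$-subsets of $\mathbf Q$ that are neither $\emptyset$ nor $\mathbf Q$, have no greatest element, and contain every rational less than any element they contain. Addition $+$, multiplication $\cdot$ and the order $\le$ (inclusion) on cuts are the standard ones. **Theorem 3.2.** $\mathbf R_\iota$ is an $\iota$-class, $+$ and $\cdot$ are $\iota$-functions from $\mathbf R_\iota^2$ to $\mathbf R_\iota$, and $\le$ is an $\iota$-relation on $\mathbf R_\iota$. With these operations $\mathbf R_\iota$ is a field, and the subfield of $\mathbf R_\iota$ generated by any $\iota$-subset of $\mathbf R_\iota$ is an $\iota$-set. Every nonempty $\iota$-subset of $\mathbf R_\iota$ that is bounded above in $\mathbf R_\iota$ has a least upper bound in $\mathbf R_\iota$, and the map that takes each nonempty $\iota$-subset of $\mathbf R_\iota$ that is bounded above to its least upper bound is an $\iota$-function (from the $\iota$-class of all such $\iota$-subsets to $\mathbf R_\iota$). -/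

import Mathlib

noncomputable section

namespace IotaAnalysis

/-! ## Rudimentary functions and the set `J₂` -/

/-- Construction terms for rudimentary functions of `n` set variables: projections, unordered
pairs, differences, composition, and the union scheme `⋃_{y ∈ x₁} H(y, x₂, …, xₙ)`.
There are no terms with `n = 0`. -/
inductive RudTerm : ℕ → Type
  | proj {n : ℕ} (i : Fin n) : RudTerm n
  | upair {n : ℕ} (i j : Fin n) : RudTerm n
  | diff {n : ℕ} (i j : Fin n) : RudTerm n
  | comp {n k : ℕ} (G : RudTerm k) (H : Fin k → RudTerm n) : RudTerm n
  | union {n : ℕ} (H : RudTerm (n + 1)) : RudTerm (n + 1)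

/-- The function on sets described by a construction term. -/
def RudTerm.eval : {n : ℕ} → RudTerm n → (Fin n → ZFSet.{0}) → ZFSet.{0}
  | _, .proj i, x => x i
  | _, .upair i j, x => {x i, x j}
  | _, .diff i j, x => x i \ x j
  | _, .comp G H, x => G.eval (fun i => (H i).eval x)
  | _, .union H, x =>
      ZFSet.iUnion (fun y : (x 0 : ZFSet.{0}) => H.eval (Fin.cons (y : ZFSet.{0}) (Fin.tail x)))

/-- A function from `n`-tuples of sets to sets is rudimentary if it is generated by the
clauses above. -/
def IsRudimentary {n : ℕ} (F : (Fin n → ZFSet.{0}) → ZFSet.{0}) : Prop :=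
  ∃ t : RudTerm n, t.eval = F

/-- The set `y` is closed under application of all rudimentary functions. -/
def IsRudClosed (y : ZFSet.{0}) : Prop :=
  ∀ (n : ℕ) (F : (Fin n → ZFSet.{0}) → ZFSet.{0}), IsRudimentary F →
    ∀ v : Fin n → ZFSet.{0}, (∀ i, v i ∈ y) → F v ∈ y

/-- The rudimentary closure of the set `x`: the set of all values of rudimentary functions on
tuples from `x ∪ {x}`. By `rudClosure_isLeast` it is the smallest set which includes `x`, has
`x` as an element, and is closed under all rudimentary functions. -/
def rudClosure (x : ZFSet.{0}) : ZFSet.{0} :=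
  ZFSet.range (fun p : Σ n : ℕ, RudTerm n × (Fin n → (insert x x : ZFSet.{0})) =>
    p.2.1.eval (fun i => (p.2.2 i : ZFSet.{0})))

theorem mem_rudClosure {x z : ZFSet.{0}} :
    z ∈ rudClosure x ↔ ∃ (n : ℕ) (t : RudTerm n) (v : Fin n → ZFSet.{0}),
      (∀ i, v i ∈ insert x x) ∧ t.eval v = z := by
  unfold rudClosure
  rw [ZFSet.mem_range]
  constructor
  · rintro ⟨⟨n, t, v⟩, h⟩
    exact ⟨n, t, fun i => v i, fun i => (v i).2, h⟩
  · rintro ⟨n, t, v, hv, h⟩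
    exact ⟨⟨n, t, fun i => ⟨v i, hv i⟩⟩, h⟩

theorem isRudClosed_rudClosure (x : ZFSet.{0}) : IsRudClosed (rudClosure x) := by
  rintro n F ⟨t, rfl⟩ v hv
  choose m s w hw hs using fun i => mem_rudClosure.1 (hv i)
  let e := finSigmaFinEquiv (n := m)
  refine mem_rudClosure.2 ⟨_, RudTerm.comp t (fun i => RudTerm.comp (s i)
    (fun j => RudTerm.proj (e ⟨i, j⟩))), fun k => w (e.symm k).1 (e.symm k).2,
    fun k => hw _ _, ?_⟩
  let u : (Σ i, Fin (m i)) → ZFSet.{0} := fun p => w p.1 p.2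
  change t.eval (fun i => (s i).eval fun j => u (e.symm (e ⟨i, j⟩))) = t.eval v
  simp only [Equiv.symm_apply_apply]
  congr 1
  funext i
  exact hs i

/-- `rudClosure x` is the smallest rudimentarily closed set including `x` and containing `x`. -/
theorem rudClosure_isLeast (x : ZFSet.{0}) :
    IsLeast {y : ZFSet.{0} | x ⊆ y ∧ x ∈ y ∧ IsRudClosed y} (rudClosure x) := by
  have key : ∀ z ∈ insert x x, z ∈ rudClosure x := fun z hz =>
    mem_rudClosure.2 ⟨1, RudTerm.proj 0, fun _ => z, fun _ => hz, rfl⟩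
  refine ⟨⟨fun z hz => key z (ZFSet.mem_insert_of_mem x hz), key x (ZFSet.mem_insert x x),
    isRudClosed_rudClosure x⟩, ?_⟩
  rintro y ⟨hsub, hmem, hcl⟩ z hz
  obtain ⟨n, t, v, hv, rfl⟩ := mem_rudClosure.1 hz
  refine hcl n _ ⟨t, rfl⟩ v (fun i => ?_)
  rcases ZFSet.mem_insert_iff.1 (hv i) with h | h
  · rw [h]; exact hmem
  · exact hsub h

/-- `J₁` is the rudimentary closure of `J₀ = ∅`. -/
def J1 : ZFSet.{0} := rudClosure ∅

/-- `J₂` is the rudimentary closure of `J₁`. -/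
def J2 : ZFSet.{0} := rudClosure J1

/-! ## Definable subsets -/

/-- The non-logical symbols of the language of set theory: `∈` and `⊆` (equality is logical). -/
inductive SetRel : ℕ → Type
  | mem : SetRel 2
  | sub : SetRel 2

/-- The first-order language with the two binary relation symbols `∈` and `⊆`. -/
def setLanguage : FirstOrder.Language := ⟨fun _ => Empty, SetRel⟩

/-- The interpretation of the language of set theory in the universe of discourse `x`. -/
instance setStructure (x : ZFSet.{0}) : setLanguage.Structure x where
  funMap := fun f _ => f.elim
  RelMap := fun r =>
    match r with
    | .mem => fun v => (v 0 : ZFSet.{0}) ∈ (v 1 : ZFSet.{0})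
    | .sub => fun v => (v 0 : ZFSet.{0}) ⊆ (v 1 : ZFSet.{0})

/-- `Y` is a definable subset of `x`: it is defined by a formula of set theory relativized to `x`,
with parameters from `x`. -/
def IsDefinableSubset (x : ZFSet.{0}) (Y : Set ZFSet.{0}) : Prop :=
  (∀ a ∈ Y, a ∈ x) ∧ (Set.univ : Set x).Definable₁ setLanguage {a : x | (a : ZFSet.{0}) ∈ Y}

/-! ## ι-sets, ι-classes, ι-relations and ι-functions -/

/-- An ι-set is an element of `J₂`. -/
def IsIotaSet (x : ZFSet.{0}) : Prop := x ∈ J2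

/-- An ι-class is a definable subset of `J₂` whose intersection with every ι-set is an ι-set. -/
def IsIotaClass (X : Set ZFSet.{0}) : Prop :=
  IsDefinableSubset J2 X ∧
    ∀ z : ZFSet.{0}, IsIotaSet z → IsIotaSet (z.sep (fun a => a ∈ X))

/-- The ι-subsets of `X`: the ι-sets all of whose elements belong to `X`. -/
def IsIotaSubset (x : ZFSet.{0}) (X : Set ZFSet.{0}) : Prop :=
  IsIotaSet x ∧ (x : Set ZFSet.{0}) ⊆ X

/-- The cartesian product of two classes, with Kuratowski pairs. -/
def classProd (X Y : Set ZFSet.{0}) : Set ZFSet.{0} :=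
  {z | ∃ a ∈ X, ∃ b ∈ Y, z = ZFSet.pair a b}

/-- The graph of a function `F` with domain `X`. -/
def graph (X : Set ZFSet.{0}) (F : ZFSet.{0} → ZFSet.{0}) : Set ZFSet.{0} :=
  {z | ∃ a ∈ X, z = ZFSet.pair a (F a)}

/-- `R` is an ι-relation on the ι-class `X`. -/
def IsIotaRelation (X R : Set ZFSet.{0}) : Prop :=
  IsIotaClass X ∧ IsIotaClass R ∧ R ⊆ classProd X X

/-- `F` (restricted to `X`) is an ι-function from the ι-class `X` to the ι-class `Y`: it maps `X`
to `Y`, its graph is an ι-class, and the image of each ι-subset of `X` is contained in an ι-set.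
The values of `F` outside `X` play no role. -/
structure IsIotaFunction (X Y : Set ZFSet.{0}) (F : ZFSet.{0} → ZFSet.{0}) : Prop where
  domain : IsIotaClass X
  codomain : IsIotaClass Y
  mapsTo : Set.MapsTo F X Y
  graph_class : IsIotaClass (graph X F)
  image_bound : ∀ x : ZFSet.{0}, IsIotaSubset x X → ∃ y : ZFSet.{0}, IsIotaSet y ∧ ∀ a ∈ x, F a ∈ y

open Classical in
/-- The first component of an ordered pair (and `∅` for sets which are not ordered pairs). -/
def fst (p : ZFSet.{0}) : ZFSet.{0} :=
  if h : ∃ a b : ZFSet.{0}, p = ZFSet.pair a b then h.choose else ∅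

open Classical in
/-- The second component of an ordered pair (and `∅` for sets which are not ordered pairs). -/
def snd (p : ZFSet.{0}) : ZFSet.{0} :=
  if h : ∃ b a : ZFSet.{0}, p = ZFSet.pair a b then h.choose else ∅

/-! ## Numbers as sets -/

/-- The natural number `n` as the set `{0, …, n - 1}`. -/
def natCode : ℕ → ZFSet.{0}
  | 0 => ∅
  | n + 1 => insert (natCode n) (natCode n)

/-- The integer `z` as a block of the usual equivalence relation on pairs of natural numbers:
the set of all `⟨m, n⟩` with `m - n = z`. -/
def intCode (z : ℤ) : ZFSet.{0} :=
  ZFSet.range (fun p : {p : ℕ × ℕ // (p.1 : ℤ) - (p.2 : ℤ) = z} =>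
    ZFSet.pair (natCode p.1.1) (natCode p.1.2))

/-- The rational number `q` as a block of the usual equivalence relation on pairs of integers with
nonzero second component: the set of all `⟨a, b⟩` with `b ≠ 0` and `a / b = q`. -/
def ratCode (q : ℚ) : ZFSet.{0} :=
  ZFSet.range (fun p : {p : ℤ × ℤ // p.2 ≠ 0 ∧ (p.1 : ℚ) / (p.2 : ℚ) = q} =>
    ZFSet.pair (intCode p.1.1) (intCode p.1.2))

/-- The set of all rational numbers. -/
def ratSet : ZFSet.{0} := ZFSet.range ratCode

/-- The rational numbers (in the sense of Mathlib) that belong to the set `x`. -/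
def toRats (x : ZFSet.{0}) : Set ℚ := {q | ratCode q ∈ x}

/-- A set of rational numbers (in the sense of Mathlib) as a subset of `ratSet`. -/
def ofRats (A : Set ℚ) : ZFSet.{0} := ZFSet.range (fun q : A => ratCode q)

/-! ## Dedekind cuts and their standard operations -/

/-- Lower Dedekind cuts of `ℚ`. -/
def IsCut (A : Set ℚ) : Prop :=
  A ≠ ∅ ∧ A ≠ Set.univ ∧ (¬ ∃ a, IsGreatest A a) ∧ ∀ a ∈ A, ∀ b < a, b ∈ A

/-- The sum of two cuts. -/
def cutAdd (A B : Set ℚ) : Set ℚ := {q | ∃ a ∈ A, ∃ b ∈ B, q = a + b}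

/-- The additive inverse of a cut. -/
def cutNeg (A : Set ℚ) : Set ℚ := {q | ∃ r, r ∉ A ∧ q < -r}

/-- The cut of the number zero. -/
def cutZero : Set ℚ := {q | q < 0}

/-- The product of two nonnegative cuts. -/
def cutMulNonneg (A B : Set ℚ) : Set ℚ :=
  cutZero ∪ {q | ∃ a ∈ A, ∃ b ∈ B, 0 ≤ a ∧ 0 ≤ b ∧ q = a * b}

open Classical in
/-- The product of two cuts, by the usual sign rules. -/
def cutMul (A B : Set ℚ) : Set ℚ :=
  if cutZero ⊆ A then
    if cutZero ⊆ B then cutMulNonneg A B else cutNeg (cutMulNonneg A (cutNeg B))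
  else
    if cutZero ⊆ B then cutNeg (cutMulNonneg (cutNeg A) B)
    else cutMulNonneg (cutNeg A) (cutNeg B)

/-! ## The ι-real line -/

/-- The ι-real line: the set of all Dedekind ι-cuts, i.e. of the ι-subsets of the set of rational
numbers which are lower Dedekind cuts. As a subtype of `ZFSet` it carries the order `≤` given by
inclusion, which is the standard order of cuts. -/
def RIota : Set ZFSet.{0} :=
  {x | IsIotaSubset x (ratSet : Set ZFSet.{0}) ∧ IsCut (toRats x)}

/-- Addition of cuts, as an operation on sets. -/
def add (x y : ZFSet.{0}) : ZFSet.{0} := ofRats (cutAdd (toRats x) (toRats y))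

/-- Multiplication of cuts, as an operation on sets. -/
def mul (x y : ZFSet.{0}) : ZFSet.{0} := ofRats (cutMul (toRats x) (toRats y))

/-- The order relation of the ι-real line, as a class of ordered pairs. -/
def leRel : Set ZFSet.{0} :=
  {z | ∃ a b : RIota, a ≤ b ∧ z = ZFSet.pair (a : ZFSet.{0}) (b : ZFSet.{0})}

/-- The elements of the ι-real line that belong to the set `x`. -/
def realsIn (x : ZFSet.{0}) : Set RIota := {a | (a : ZFSet.{0}) ∈ x}

/-- The class of all nonempty ι-subsets of the ι-real line which are bounded above in it. -/
def boundedSubsets : Set ZFSet.{0} :=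
  {x | IsIotaSubset x RIota ∧ (realsIn x).Nonempty ∧ BddAbove (realsIn x)}

end IotaAnalysis

end

noncomputable section

namespace IotaAnalysis

/-! ## Rudimentary functions of environments -/

/-! `J2` is transitive and closed under rudimentary functions, and a rudimentary function with
parameters from `J2` is definable over `J2`. Therefore a rudimentary relation cuts an ι-class out of
`J2`: separation by the relation is itself rudimentary, so intersections with ι-sets are ι-sets.
Likewise a rudimentary function between such classes is an ι-function, because the image of an ι-set
under it is a value of a rudimentary function. `IotaFun.isIotaClass` and `IsRudClass.isIotaFunction`
express this, and it remains to see that everything in the theorem is rudimentary. Quantifiers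
bounded by an ι-set are allowed for this purpose.

The numbers are ι-sets: ℕ is separated from `J1`, while ℤ and ℚ are ranges of rudimentary functions
on ι-sets. Primitive recursion on ℕ is rudimentary because finite computations are elements of the
parameter `J1` (`IotaFun.natRec`). Being a cut, and the sums and products of cuts, involve
quantifiers over ℚ only. The field axioms come from ℝ: a cut is the lower cut of a real number, and
the reals whose cuts are in `J2` form a subfield `iotaReals`. The least upper bound of a set of cuts
is its union.

The generated subfield needs two more ideas. By `exists_cover`, the elements of an ι-set are among
the values of a rudimentary function on `J1`, so generators can be indexed by elements of `J1` and
field terms over them are again elements of `J1`. The value of a term is an infinite set and is not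
computed by recursion. Instead, finite derivations of rational bounds for values of terms are
elements of `J1`, and a rational lies below the value of a term if and only if some derivation
proves a greater lower bound (`HasValue.derivedCut_eq`). This makes the cut of a term a rudimentary
function of the term. Its range, without the empty set that undefined terms produce, is the
generated subfield. -/

/-- Environments: assignments of sets to the variables `0, 1, 2, …`. -/
abbrev Env := ℕ → ZFSet.{0}

/-- The environment `v` shifted by one place, with `y` as the new value of the variable `0`. -/
def push (y : ZFSet.{0}) (v : Env) : Env
  | 0 => y
  | n + 1 => v n

/-- The environment without its variable `0`. -/
abbrev pop (v : Env) : Env := fun n => v (n + 1)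

/-- Functions of environments which are obtained from a rudimentary function by filling its
places with variables and with parameters from `J₂`. -/
class IotaRud (f : Env → ZFSet.{0}) : Prop where
  exists_term : ∃ (k : ℕ) (t : RudTerm k) (a : Fin k → ℕ ⊕ J2),
    ∀ v, f v = t.eval (fun i => Sum.elim v Subtype.val (a i))

/-- The union of the sets `g y` for `y ∈ x`. -/
def biUnion (x : ZFSet.{0}) (g : ZFSet.{0} → ZFSet.{0}) : ZFSet.{0} :=
  ZFSet.iUnion (fun y : x => g y)

@[simp] theorem mem_biUnion {x z : ZFSet.{0}} {g : ZFSet.{0} → ZFSet.{0}} :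
    z ∈ biUnion x g ↔ ∃ y ∈ x, z ∈ g y := by
  simp [biUnion]

protected theorem IotaRud.congr {f g : Env → ZFSet.{0}} (hf : IotaRud f) (h : ∀ v, g v = f v) :
    IotaRud g := by
  rwa [funext h]

protected instance IotaRud.proj (i : ℕ) : IotaRud (fun v => v i) :=
  ⟨1, .proj 0, fun _ => .inl i, fun _ => rfl⟩

protected theorem IotaRud.const {c : ZFSet.{0}} (hc : c ∈ J2) : IotaRud (fun _ => c) :=
  ⟨1, .proj 0, fun _ => .inr ⟨c, hc⟩, fun _ => rfl⟩

protected theorem IotaRud.eval {k : ℕ} (t : RudTerm k) {g : Fin k → Env → ZFSet.{0}}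
    (hg : ∀ i, IotaRud (g i)) : IotaRud (fun v => t.eval (fun i => g i v)) := by
  choose m s a h using fun i => (hg i).exists_term
  let e := finSigmaFinEquiv (n := m)
  refine ⟨_, .comp t (fun i => .comp (s i) (fun j => .proj (e ⟨i, j⟩))),
    fun l => a (e.symm l).1 (e.symm l).2, fun v => ?_⟩
  let u : (Σ i, Fin (m i)) → ZFSet.{0} := fun p => Sum.elim v Subtype.val (a p.1 p.2)
  change _ = t.eval (fun i => (s i).eval fun j => u (e.symm (e ⟨i, j⟩)))
  simp only [Equiv.symm_apply_apply]
  congr 1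
  funext i
  exact h i v

/-- Substitution of rudimentary functions for the variables. -/
protected theorem IotaRud.subst {f : Env → ZFSet.{0}} (hf : IotaRud f) {σ : Env → Env}
    (hσ : ∀ i, IotaRud (fun v => σ v i)) : IotaRud (fun v => f (σ v)) := by
  obtain ⟨k, t, a, h⟩ := hf
  refine (IotaRud.eval t (g := fun i v => Sum.elim (σ v) Subtype.val (a i)) fun i => ?_).congr
    fun v => h (σ v)
  rcases a i with n | c
  · exact hσ n
  · exact .const c.2

protected instance IotaRud.upair (f g : Env → ZFSet.{0}) [hf : IotaRud f] [hg : IotaRud g] :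
    IotaRud (fun v => {f v, g v}) :=
  IotaRud.congr (IotaRud.eval (.upair 0 1) (g := ![f, g]) (by
    intro i; fin_cases i
    · exact hf
    · exact hg)) fun _ => rfl

protected instance IotaRud.sdiff (f g : Env → ZFSet.{0}) [hf : IotaRud f] [hg : IotaRud g] :
    IotaRud (fun v => f v \ g v) :=
  IotaRud.congr (IotaRud.eval (.diff 0 1) (g := ![f, g]) (by
    intro i; fin_cases i
    · exact hf
    · exact hg)) fun _ => rfl

protected instance IotaRud.biUnion (f : Env → ZFSet.{0}) (g : Env → ZFSet.{0} → ZFSet.{0})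
    [hf : IotaRud f] [hg : IotaRud (fun w => g (pop w) (w 0))] :
    IotaRud (fun v => biUnion (f v) (g v)) := by
  classical
  obtain ⟨k, t, a, h⟩ := hg
  let T : RudTerm (k + 1) :=
    .union (.comp t (fun i => if a i = .inl 0 then .proj 0 else .proj i.succ))
  -- At occurrences of the variable `0` the term `T` reads the bound variable instead of `b`, so the
  -- truncated value `0 - 1 = 0` there is harmless.
  let b : Fin k → Env → ZFSet.{0} := fun i v => Sum.elim (fun n => v (n - 1)) Subtype.val (a i)
  have hb : ∀ i, IotaRud (b i) := by
    intro i
    rcases hi : a i with n | c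
    · exact (IotaRud.proj (n - 1)).congr fun v => by simp [b, hi]
    · exact (IotaRud.const c.2).congr fun v => by simp [b, hi]
  refine (IotaRud.eval T (g := Fin.cons f b) (fun i => ?_)).congr fun v => ?_
  · refine Fin.cases ?_ (fun i => ?_) i
    · exact hf
    · exact hb i
  · change ZFSet.iUnion (fun y : (f v : ZFSet.{0}) => g v y) =
      ZFSet.iUnion (fun y : (f v : ZFSet.{0}) => _)
    congr 1
    funext y
    refine (h (push y v)).trans ?_
    change t.eval _ = t.eval _
    congr 1
    funext i
    rcases hi : a i with (_ | n) | c
    · simp [push, RudTerm.eval, hi]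
    · simp [push, RudTerm.eval, b, hi, Fin.tail]
    · simp [RudTerm.eval, b, hi, Fin.tail]

theorem mem_J2_of_isRudimentary {n : ℕ} (t : RudTerm n) {v : Fin n → ZFSet.{0}}
    (hv : ∀ i, v i ∈ J2) : t.eval v ∈ J2 :=
  isRudClosed_rudClosure J1 n _ ⟨t, rfl⟩ v hv

protected theorem IotaRud.mem_J2 {f : Env → ZFSet.{0}} (hf : IotaRud f) {v : Env} (hv : ∀ i, v i ∈ J2) :
    f v ∈ J2 := by
  obtain ⟨k, t, a, h⟩ := hf
  rw [h]
  refine mem_J2_of_isRudimentary t fun i => ?_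
  rcases a i with n | c
  · exact hv n
  · exact c.2

theorem J1_mem_J2 : J1 ∈ J2 := (rudClosure_isLeast J1).1.2.1

theorem J1_subset_J2 : J1 ⊆ J2 := (rudClosure_isLeast J1).1.1

theorem empty_mem_J1 : ∅ ∈ J1 := (rudClosure_isLeast ∅).1.2.1

theorem empty_mem_J2 : ∅ ∈ J2 := J1_subset_J2 empty_mem_J1

protected instance IotaRud.empty : IotaRud (fun _ => ∅) := .const empty_mem_J2

protected instance IotaRud.singleton (f : Env → ZFSet.{0}) [IotaRud f] : IotaRud (fun v => {f v}) :=
  (IotaRud.upair f f).congr fun v => by simp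

protected instance IotaRud.union (f g : Env → ZFSet.{0}) [IotaRud f] [IotaRud g] :
    IotaRud (fun v => f v ∪ g v) :=
  (inferInstance : IotaRud (fun v => biUnion {f v, g v} fun y => y)).congr fun v => by
    ext z; simp

protected instance IotaRud.pair (f g : Env → ZFSet.{0}) [IotaRud f] [IotaRud g] :
    IotaRud (fun v => ZFSet.pair (f v) (g v)) :=
  inferInstanceAs (IotaRud (fun v => {{f v}, {f v, g v}}))

/-- The first component of an ordered pair, as a rudimentary function. -/
def rudFst (p : ZFSet.{0}) : ZFSet.{0} :=
  -- The double difference is `{{a}} ∩ p`, which is nonempty exactly when `{a} ∈ p`.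
  biUnion (biUnion p fun y => y) fun a => biUnion ({{a}} \ ({{a}} \ p)) fun _ => a

/-- The second component of an ordered pair, as a rudimentary function. -/
def rudSnd (p : ZFSet.{0}) : ZFSet.{0} :=
  -- The first union is the member of `⋃ p` other than the first component. If the components
  -- coincide it is empty, and `p` has no element besides the singleton of the first component, so
  -- the second union supplies that component.
  biUnion (biUnion p (fun y => y) \ {rudFst p}) (fun y => y) ∪
    biUnion ({∅} \ biUnion (p \ {{rudFst p}}) fun _ => {∅}) fun _ => rudFst p

@[simp] theorem rudFst_pair (a b : ZFSet.{0}) : rudFst (ZFSet.pair a b) = a := by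
  ext z
  simp only [rudFst, ZFSet.pair, mem_biUnion, ZFSet.mem_pair, ZFSet.mem_sdiff,
    ZFSet.mem_singleton, not_and, not_not]
  constructor
  · rintro ⟨c, -, y, ⟨rfl, hy⟩, hz⟩
    rcases hy rfl with h | h
    · rwa [← ZFSet.singleton_injective h]
    · rwa [← (ZFSet.singleton_eq_pair_iff.1 h).1]
  · intro h
    exact ⟨a, ⟨{a}, .inl rfl, by simp⟩, {a}, ⟨rfl, fun _ => .inl rfl⟩, h⟩

@[simp] theorem rudSnd_pair (a b : ZFSet.{0}) : rudSnd (ZFSet.pair a b) = b := by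
  rw [rudSnd, rudFst_pair]
  ext z
  simp only [ZFSet.pair, mem_biUnion, ZFSet.mem_pair, ZFSet.mem_sdiff, ZFSet.mem_union,
    ZFSet.mem_singleton, not_exists, not_and]
  constructor
  · rintro (⟨c, ⟨⟨y, rfl | rfl, hy⟩, hc⟩, hz⟩ | ⟨y, ⟨rfl, h⟩, hz⟩)
    · exact absurd (ZFSet.mem_singleton.1 hy) hc
    · rcases ZFSet.mem_pair.1 hy with h | h
      · exact absurd h hc
      · rwa [← h]
    · by_cases hab : a = b
      · rwa [← hab]
      · refine (h {a, b} ⟨.inr rfl, fun h' => hab ?_⟩ rfl).elim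
        exact (ZFSet.pair_eq_singleton_iff.1 h').2.symm
  · intro hz
    by_cases hab : a = b
    · subst hab
      refine .inr ⟨∅, ⟨rfl, ?_⟩, hz⟩
      rintro c ⟨rfl | rfl, h⟩ <;> simp at h
    · exact .inl ⟨b, ⟨⟨{a, b}, .inr rfl, by simp⟩, fun h => hab h.symm⟩, hz⟩

protected instance IotaRud.rudFst : IotaRud (fun v => rudFst (v 0)) :=
  (inferInstance : IotaRud (fun v => biUnion (biUnion (v 0) fun y => y)
    fun a => biUnion ({{a}} \ ({{a}} \ v 0)) fun _ => a))

protected instance IotaRud.rudSnd : IotaRud (fun v => rudSnd (v 0)) := by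
  have h : IotaRud (fun v => rudFst (v 1)) :=
    IotaRud.rudFst.subst (σ := fun v _ => v 1) fun _ => inferInstance
  exact (inferInstance : IotaRud (fun v =>
    biUnion (biUnion (v 0) (fun y => y) \ {rudFst (v 0)})
      (fun y => y) ∪ biUnion
        ({∅} \ biUnion (v 0 \ {{rudFst (v 0)}}) fun _ => {∅})
        fun _ => rudFst (v 0)))

/-! ## Rudimentary functions between coded types -/

/-- Types whose elements are coded by sets. -/
class IotaType (α : Type*) where
  code : α → ZFSet.{0}
  code_injective : Function.Injective code

open IotaType (code)

open Classical in
/-- The truth value `1 = {∅}` or `0 = ∅` of a proposition. -/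
def truth (p : Prop) : ZFSet.{0} := if p then {∅} else ∅

@[simp] theorem mem_truth {p : Prop} {z : ZFSet.{0}} : z ∈ truth p ↔ p ∧ z = ∅ := by
  by_cases h : p <;> simp [truth, h]

theorem truth_injective : Function.Injective truth := fun _ _ h => by
  have := congrArg (∅ ∈ ·) h
  simpa using this

instance : IotaType ZFSet.{0} := ⟨id, Function.injective_id⟩

instance : IotaType Prop := ⟨truth, truth_injective⟩

instance {α β : Type*} [IotaType α] [IotaType β] : IotaType (α × β) :=
  ⟨fun p => ZFSet.pair (code p.1) (code p.2), fun _ _ h =>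
    Prod.ext (IotaType.code_injective (ZFSet.pair_inj.1 h).1)
      (IotaType.code_injective (ZFSet.pair_inj.1 h).2)⟩

@[simp] theorem code_ZFSet (x : ZFSet.{0}) : code x = x := rfl
@[simp] theorem code_Prop (p : Prop) : code p = truth p := rfl

section

variable {α β γ : Type*} [IotaType α] [IotaType β] [IotaType γ]

@[simp] theorem code_prod (a : α) (b : β) : code (a, b) = ZFSet.pair (code a) (code b) := rfl

/-- Functions between coded types which, on codes, are given by a rudimentary function with
parameters from `J₂`. -/
@[fun_prop]
def IotaFun (f : α → β) : Prop :=
  ∃ F : Env → ZFSet.{0}, IotaRud F ∧ ∀ a, code (f a) = F (fun _ => code a)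

@[fun_prop]
protected theorem IotaFun.id : IotaFun (fun a : α => a) := ⟨fun v => v 0, inferInstance, fun _ => rfl⟩

protected theorem IotaFun.const_of_mem {b : β} (hb : code b ∈ J2) : IotaFun (fun _ : α => b) :=
  ⟨fun _ => code b, .const hb, fun _ => rfl⟩

@[fun_prop]
protected theorem IotaFun.comp {f : β → γ} {g : α → β} (hf : IotaFun f) (hg : IotaFun g) :
    IotaFun (fun a => f (g a)) := by
  obtain ⟨F, hF, h⟩ := hf
  obtain ⟨G, hG, h'⟩ := hg
  exact ⟨fun v => F (fun _ => G v), hF.subst fun _ => hG, fun a => by rw [h, h']⟩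

@[fun_prop]
protected theorem IotaFun.prodMk {f : α → β} {g : α → γ} (hf : IotaFun f) (hg : IotaFun g) :
    IotaFun (fun a => (f a, g a)) := by
  obtain ⟨F, hF, h⟩ := hf
  obtain ⟨G, hG, h'⟩ := hg
  exact ⟨fun v => ZFSet.pair (F v) (G v), inferInstance, fun a => by simp [h, h']⟩

@[fun_prop]
protected theorem IotaFun.fst {f : α → β × γ} (hf : IotaFun f) : IotaFun (fun a => (f a).1) :=
  IotaFun.comp ⟨fun v => rudFst (v 0), inferInstance, fun p => by simp [code]⟩ hf

@[fun_prop]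
protected theorem IotaFun.snd {f : α → β × γ} (hf : IotaFun f) : IotaFun (fun a => (f a).2) :=
  IotaFun.comp ⟨fun v => rudSnd (v 0), inferInstance, fun p => by simp [code]⟩ hf

protected theorem IotaFun.congr {f g : α → β} (hf : IotaFun f) (h : ∀ a, g a = f a) : IotaFun g := by
  rwa [funext h]

@[fun_prop]
protected theorem IotaFun.toCode {f : α → β} (hf : IotaFun f) : IotaFun (fun a => code (f a)) := hf

protected theorem IotaFun.mem_J2 {f : α → β} (hf : IotaFun f) {a : α} (ha : code a ∈ J2) :
    code (f a) ∈ J2 := by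
  obtain ⟨F, hF, h⟩ := hf
  rw [h]
  exact hF.mem_J2 fun _ => ha

@[fun_prop]
protected theorem IotaFun.empty : IotaFun (fun _ : α => (∅ : ZFSet.{0})) := .const_of_mem empty_mem_J2

@[fun_prop]
protected theorem IotaFun.upair {f g : α → ZFSet.{0}} (hf : IotaFun f) (hg : IotaFun g) :
    IotaFun (fun a => ({f a, g a} : ZFSet.{0})) := by
  obtain ⟨F, hF, h⟩ := hf
  obtain ⟨G, hG, h'⟩ := hg
  exact ⟨fun v => {F v, G v}, inferInstance, fun a => by simp [← h, ← h']⟩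

@[fun_prop]
protected theorem IotaFun.sdiff {f g : α → ZFSet.{0}} (hf : IotaFun f) (hg : IotaFun g) :
    IotaFun (fun a => f a \ g a) := by
  obtain ⟨F, hF, h⟩ := hf
  obtain ⟨G, hG, h'⟩ := hg
  exact ⟨fun v => F v \ G v, inferInstance, fun a => by simp [← h, ← h']⟩

@[fun_prop]
protected theorem IotaFun.biUnion {f : α → ZFSet.{0}} {g : α → ZFSet.{0} → ZFSet.{0}} (hf : IotaFun f)
    (hg : IotaFun fun p : α × ZFSet.{0} => g p.1 p.2) :
    IotaFun (fun a => biUnion (f a) (g a)) := by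
  obtain ⟨F, hF, h⟩ := hf
  obtain ⟨G, hG, h'⟩ := hg
  have : IotaRud fun v => G (fun _ => ZFSet.pair (v 1) (v 0)) := hG.subst fun _ => inferInstance
  refine ⟨fun v => biUnion (F v) fun y => G fun _ => ZFSet.pair (v 0) y,
    IotaRud.biUnion _ _, fun a => ?_⟩
  simp only [code_ZFSet, ← h]
  congr 1
  funext y
  exact h' (a, y)

@[fun_prop]
protected theorem IotaFun.singleton {f : α → ZFSet.{0}} (hf : IotaFun f) :
    IotaFun (fun a => ({f a} : ZFSet.{0})) := by
  have : IotaFun (fun a => ({f a, f a} : ZFSet.{0})) := by fun_prop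
  simpa using this

@[fun_prop]
protected theorem IotaFun.sUnion {f : α → ZFSet.{0}} (hf : IotaFun f) :
    IotaFun (fun a => ZFSet.sUnion (f a)) := by
  have : IotaFun (fun a => biUnion (f a) fun y => y) := by fun_prop
  exact this.congr fun a => by ext z; simp

@[fun_prop]
protected theorem IotaFun.union {f g : α → ZFSet.{0}} (hf : IotaFun f) (hg : IotaFun g) :
    IotaFun (fun a => f a ∪ g a) := by
  have : IotaFun (fun a => ZFSet.sUnion {f a, g a}) := by fun_prop
  exact this.congr fun a => by ext z; simp

/-! ### Relations -/

@[fun_prop]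
protected theorem IotaFun.truth {P : α → Prop} (hP : IotaFun P) : IotaFun (fun a => truth (P a)) := hP

protected theorem IotaFun.of_truth {P : α → Prop} {f : α → ZFSet.{0}} (hf : IotaFun f)
    (h : ∀ a, f a = truth (P a)) : IotaFun P :=
  (hf.congr fun a => (h a).symm : IotaFun (fun a => truth (P a)))

theorem truth_mem_J2 (p : Prop) : truth p ∈ J2 := by
  by_cases h : p
  · have : IotaRud (fun _ => {(∅ : ZFSet.{0})}) := inferInstance
    simpa [truth, h] using this.mem_J2 (v := fun _ => ∅) fun _ => empty_mem_J2
  · simpa [truth, h] using empty_mem_J2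

@[fun_prop]
protected theorem IotaFun.const_prop (p : Prop) : IotaFun (fun _ : α => p) :=
  .const_of_mem (truth_mem_J2 p)

protected theorem IotaFun.exists_mem {f : α → ZFSet.{0}} (hf : IotaFun f) :
    IotaFun (fun a => ∃ y, y ∈ f a) :=
  (by fun_prop : IotaFun fun a => biUnion (f a) fun _ => {∅}).of_truth fun v => by
    ext z; simp

@[fun_prop]
protected theorem IotaFun.not {P : α → Prop} (hP : IotaFun P) : IotaFun (fun a => ¬ P a) :=
  (by fun_prop : IotaFun fun a => {∅} \ truth (P a)).of_truth fun a => by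
    ext z; simp; tauto

@[fun_prop]
protected theorem IotaFun.or {P Q : α → Prop} (hP : IotaFun P) (hQ : IotaFun Q) :
    IotaFun (fun a => P a ∨ Q a) :=
  (by fun_prop : IotaFun fun a => truth (P a) ∪ truth (Q a)).of_truth
    fun a => by ext z; simp; tauto

@[fun_prop]
protected theorem IotaFun.and {P Q : α → Prop} (hP : IotaFun P) (hQ : IotaFun Q) :
    IotaFun (fun a => P a ∧ Q a) :=
  (by fun_prop : IotaFun fun a => ¬ (¬ P a ∨ ¬ Q a)).congr fun a => by simp

@[fun_prop]
protected theorem IotaFun.imp {P Q : α → Prop} (hP : IotaFun P) (hQ : IotaFun Q) :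
    IotaFun (fun a => P a → Q a) :=
  (by fun_prop : IotaFun fun a => ¬ P a ∨ Q a).congr fun a => by simp [imp_iff_not_or]

@[fun_prop]
protected theorem IotaFun.bex {f : α → ZFSet.{0}} {P : α → ZFSet.{0} → Prop} (hf : IotaFun f)
    (hP : IotaFun fun p : α × ZFSet.{0} => P p.1 p.2) :
    IotaFun (fun a => ∃ y ∈ f a, P a y) :=
  (by fun_prop : IotaFun fun a =>
    biUnion (f a) fun y => truth (P a y)).of_truth fun a => by
      ext z; simp; tauto

@[fun_prop]
protected theorem IotaFun.subset {f g : α → ZFSet.{0}} (hf : IotaFun f) (hg : IotaFun g) :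
    IotaFun (fun a => f a ⊆ g a) :=
  (by have := (hf.sdiff hg).exists_mem; fun_prop :
    IotaFun fun a => ¬ ∃ y, y ∈ f a \ g a).congr fun a => by simp [ZFSet.subset_def]

@[fun_prop]
protected theorem IotaFun.eq {f g : α → β} (hf : IotaFun f) (hg : IotaFun g) :
    IotaFun (fun a => f a = g a) :=
  (by fun_prop : IotaFun fun a => code (f a) ⊆ code (g a) ∧ code (g a) ⊆ code (f a)).congr
    fun a => by
      rw [eq_iff_iff, ← IotaType.code_injective.eq_iff]
      constructor
      · intro h; simp [h]
      · rintro ⟨h, h'⟩; exact SetLike.coe_injective (Set.Subset.antisymm h h')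

@[fun_prop]
protected theorem IotaFun.mem {f g : α → ZFSet.{0}} (hf : IotaFun f) (hg : IotaFun g) :
    IotaFun (fun a => f a ∈ g a) :=
  (by fun_prop : IotaFun fun a => {f a} ⊆ g a).congr fun a => by simp [ZFSet.subset_def]

open Classical in
@[fun_prop]
protected theorem IotaFun.ite {P : α → Prop} {f g : α → ZFSet.{0}} (hP : IotaFun P) (hf : IotaFun f)
    (hg : IotaFun g) : IotaFun (fun a => if P a then f a else g a) :=
  -- A union indexed by the truth value of a proposition keeps the set if the proposition holds and
  -- is empty otherwise.
  (by fun_prop : IotaFun fun a =>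
    (biUnion (truth (P a)) fun _ => f a) ∪
    (biUnion (truth (¬ P a)) fun _ => g a)).congr fun a => by
  ext z
  by_cases h : P a <;> simp [h]

@[fun_prop]
protected theorem IotaFun.sep {f : α → ZFSet.{0}} {P : α → ZFSet.{0} → Prop} (hf : IotaFun f)
    (hP : IotaFun fun p : α × ZFSet.{0} => P p.1 p.2) :
    IotaFun (fun a => (f a).sep (P a)) :=
  (by fun_prop : IotaFun fun a => biUnion (f a) fun y =>
    biUnion (truth (P a y)) fun _ => {y}).congr fun a => by
  ext z
  simp only [ZFSet.mem_sep, mem_biUnion, mem_truth, ZFSet.mem_singleton]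
  constructor
  · rintro ⟨h, h'⟩
    exact ⟨z, h, ∅, ⟨h', rfl⟩, rfl⟩
  · rintro ⟨y, hy, -, ⟨h, -⟩, rfl⟩
    exact ⟨hy, h⟩

@[fun_prop]
protected theorem IotaFun.insert {f g : α → ZFSet.{0}} (hf : IotaFun f) (hg : IotaFun g) :
    IotaFun (fun a => insert (f a) (g a)) :=
  (by fun_prop : IotaFun fun a => {f a} ∪ g a).congr fun a => by
    ext z; simp

@[fun_prop]
protected theorem IotaFun.pair {f g : α → ZFSet.{0}} (hf : IotaFun f) (hg : IotaFun g) :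
    IotaFun (fun a => ZFSet.pair (f a) (g a)) :=
  (IotaFun.prodMk hf hg : IotaFun fun a => (f a, g a))

/-- The set of all `g y` for `y ∈ x`. -/
def replacement (x : ZFSet.{0}) (g : ZFSet.{0} → ZFSet.{0}) : ZFSet.{0} :=
  biUnion x (fun y => {g y})

end

@[simp] theorem mem_replacement {x z : ZFSet.{0}} {g : ZFSet.{0} → ZFSet.{0}} :
    z ∈ replacement x g ↔ ∃ y ∈ x, z = g y := by
  simp [replacement]

section

variable {α β γ : Type*} [IotaType α] [IotaType β] [IotaType γ]

@[fun_prop]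
protected theorem IotaFun.replacement {f : α → ZFSet.{0}} {g : α → ZFSet.{0} → ZFSet.{0}}
    (hf : IotaFun f) (hg : IotaFun fun p : α × ZFSet.{0} => g p.1 p.2) :
    IotaFun (fun a => replacement (f a) (g a)) :=
  (by fun_prop : IotaFun fun a => biUnion (f a) fun y => {g a y})

/-- Coded types whose set of codes is an ι-set. -/
class IotaSetType (γ : Type*) [IotaType γ] : Prop where
  exists_codes : ∃ s ∈ J2, ∀ z : ZFSet.{0}, z ∈ s ↔ ∃ c : γ, code c = z

variable (γ) in
/-- The set of codes of the elements of a coded type. -/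
def codes [h : IotaSetType γ] : ZFSet.{0} := h.exists_codes.choose

theorem codes_mem_J2 [h : IotaSetType γ] : codes γ ∈ J2 := h.exists_codes.choose_spec.1

theorem mem_codes [h : IotaSetType γ] {z : ZFSet.{0}} : z ∈ codes γ ↔ ∃ c : γ, code c = z :=
  h.exists_codes.choose_spec.2 z

@[simp] theorem code_mem_codes [IotaSetType γ] (c : γ) : code c ∈ codes γ := mem_codes.2 ⟨c, rfl⟩

@[fun_prop]
protected theorem IotaFun.codes [IotaSetType γ] : IotaFun (fun _ : α => codes γ) :=
  .const_of_mem codes_mem_J2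

/-- A relation with a typed variable extends to a function of the code of that variable. -/
protected theorem IotaFun.exists_extend {f : α × γ → β} (hf : IotaFun f) :
    ∃ G : α × ZFSet.{0} → ZFSet.{0}, IotaFun G ∧ ∀ a c, G (a, code c) = code (f (a, c)) := by
  obtain ⟨F, hF, h⟩ := hf
  exact ⟨fun p => F fun _ => ZFSet.pair (code p.1) p.2, ⟨F, hF, fun p => rfl⟩,
    fun a c => (h (a, c)).symm⟩

@[fun_prop]
protected theorem IotaFun.exists [IotaSetType γ] {P : α → γ → Prop}
    (hP : IotaFun fun p : α × γ => P p.1 p.2) : IotaFun (fun a => ∃ c, P a c) := by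
  obtain ⟨G, hG, h⟩ := hP.exists_extend
  refine (by fun_prop : IotaFun fun a => ∃ y ∈ codes γ, ∅ ∈ G (a, y)).congr fun a => ?_
  simp [mem_codes, h]

/-- A function into a coded type with a set of codes is rudimentary if its graph is. -/
protected theorem IotaFun.of_graph [IotaSetType γ] {f : α → γ}
    (hf : IotaFun fun p : α × γ => f p.1 = p.2) : IotaFun f := by
  obtain ⟨G, hG, h⟩ := hf.exists_extend
  -- Among the codes `y`, only the code of `f a` has truth value `1`; the union therefore returns
  -- this one code.
  refine (by fun_prop : IotaFun fun a => biUnion (codes γ) fun y => biUnion (G (a, y)) fun _ => y)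
    |>.congr (f := fun a => biUnion (codes γ) fun y => biUnion (G (a, y)) fun _ => y)
      (g := fun a => code (f a)) fun a => ?_
  ext z
  simp [mem_codes, h]

/-- The range of a rudimentary function on a coded type with a set of codes is an ι-set. -/
protected theorem IotaFun.exists_range [IotaSetType γ] {f : γ → β} (hf : IotaFun f) :
    ∃ s ∈ J2, ∀ z, z ∈ s ↔ ∃ c, code (f c) = z := by
  obtain ⟨F, hF, h⟩ := hf
  let G : ZFSet.{0} → ZFSet.{0} := fun y => F fun _ => y
  have hG : IotaFun G := ⟨F, hF, fun _ => rfl⟩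
  have h' : IotaFun fun x : ZFSet.{0} => replacement x G := by fun_prop
  refine ⟨replacement (codes γ) G, h'.mem_J2 codes_mem_J2, fun z => ?_⟩
  simp [mem_codes, h, G, eq_comm]

@[fun_prop]
protected theorem IotaFun.forall [IotaSetType γ] {P : α → γ → Prop}
    (hP : IotaFun fun p : α × γ => P p.1 p.2) : IotaFun (fun a => ∀ c, P a c) :=
  (by fun_prop : IotaFun fun a => ¬ ∃ c, ¬ P a c).congr fun a => by simp

instance [IotaSetType β] [IotaSetType γ] : IotaSetType (β × γ) := by
  have h : IotaFun fun p : ZFSet.{0} × ZFSet.{0} =>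
      biUnion p.1 fun a => replacement p.2 fun b => ZFSet.pair a b := by fun_prop
  have h' : ZFSet.pair (codes β) (codes γ) ∈ J2 := by
    have : IotaRud fun v => ZFSet.pair (v 0) (v 1) := inferInstance
    exact this.mem_J2 (v := fun n => if n = 0 then codes β else codes γ) fun i => by
      split_ifs <;> exact codes_mem_J2
  refine ⟨_, h.mem_J2 (a := (codes β, codes γ)) h', fun z => ?_⟩
  simp [mem_codes, eq_comm]

end

/-! ## Transitivity of `J₂` and definability of rudimentary relations -/

/-- Membership alone is too weak for an induction on terms, since the union scheme applies its
subterm to elements of an argument. With the hereditary property these elements are again admissible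
arguments. -/
theorem hereditarily_eval {u : ZFSet.{0}} {n : ℕ} (t : RudTerm n) {v : Fin n → ZFSet.{0}}
    (hv : ∀ i, (v i).Hereditarily (· ∈ rudClosure u)) :
    (t.eval v).Hereditarily (· ∈ rudClosure u) := by
  have hmem : ∀ {n : ℕ} (t : RudTerm n) {v : Fin n → ZFSet.{0}},
      (∀ i, (v i).Hereditarily (· ∈ rudClosure u)) → t.eval v ∈ rudClosure u :=
    fun t v hv => isRudClosed_rudClosure u _ _ ⟨t, rfl⟩ v fun i => (hv i).self
  induction t with
  | proj i => exact hv i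
  | upair i j =>
    refine ZFSet.hereditarily_iff.2 ⟨hmem _ hv, fun y hy => ?_⟩
    rcases ZFSet.mem_pair.1 hy with rfl | rfl
    · exact hv i
    · exact hv j
  | diff i j =>
    exact ZFSet.hereditarily_iff.2 ⟨hmem _ hv, fun y hy => (hv i).mem (ZFSet.mem_sdiff.1 hy).1⟩
  | comp G H ihG ihH => exact ihG fun i => ihH i hv
  | union H ih =>
    refine ZFSet.hereditarily_iff.2 ⟨hmem _ hv, fun y hy => ?_⟩
    obtain ⟨⟨w, hw⟩, h⟩ := ZFSet.mem_iUnion.1 hy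
    refine (ih (v := Fin.cons w (Fin.tail v)) fun i => ?_).mem h
    refine Fin.cases ?_ (fun i => ?_) i
    · exact (hv 0).mem hw
    · exact hv i.succ

theorem isTransitive_rudClosure {u : ZFSet.{0}} (hu : u.IsTransitive) :
    (rudClosure u).IsTransitive := by
  have hbase : ∀ z ∈ u, z.Hereditarily (· ∈ rudClosure u) := fun z =>
    ZFSet.inductionOn z fun z ih hz => ZFSet.hereditarily_iff.2
      ⟨(rudClosure_isLeast u).1.1 hz, fun y hy => ih y hy (hu.mem_trans hy hz)⟩
  have hu' : u.Hereditarily (· ∈ rudClosure u) :=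
    ZFSet.hereditarily_iff.2 ⟨(rudClosure_isLeast u).1.2.1, hbase⟩
  intro z hz y hy
  obtain ⟨n, t, v, hv, rfl⟩ := mem_rudClosure.1 hz
  refine ((hereditarily_eval t fun i => ?_).mem hy).self
  rcases ZFSet.mem_insert_iff.1 (hv i) with h | h
  · rwa [h]
  · exact hbase _ h

theorem isTransitive_J1 : J1.IsTransitive := isTransitive_rudClosure ZFSet.isTransitive_empty

theorem isTransitive_J2 : J2.IsTransitive := isTransitive_rudClosure isTransitive_J1

theorem mem_J2_of_mem {x y : ZFSet.{0}} (hx : x ∈ y) (hy : y ∈ J2) : x ∈ J2 :=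
  isTransitive_J2.mem_trans hx hy

@[fun_prop]
protected theorem IotaFun.const {α γ : Type*} [IotaType α] [IotaType γ] [IotaSetType γ] (c : γ) :
    IotaFun (fun _ : α => c) :=
  .const_of_mem (mem_J2_of_mem (code_mem_codes c) codes_mem_J2)

/-! ### Definability over `J₂` -/

section

open FirstOrder Set

variable {α β : Type}

/-- Definability over `J₂` with arbitrary parameters. -/
abbrev J2Definable (S : Set (α → J2)) : Prop := (Set.univ : Set J2).Definable setLanguage S

/-- Definability over `J₂` with arbitrary parameters, for functions. -/
abbrev J2DefinableFun (f : (α → J2) → J2) : Prop :=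
  (Set.univ : Set J2).DefinableFun setLanguage f

theorem definable_mem_var (i j : α) :
    J2Definable {v : α → J2 | (v i : ZFSet.{0}) ∈ (v j : ZFSet.{0})} := by
  let r : setLanguage[[(Set.univ : Set J2)]].Relations 2 := Sum.inl SetRel.mem
  refine ⟨r.formula₂ (Language.Term.var i) (Language.Term.var j), ?_⟩
  ext v
  have : (r.formula₂ (Language.Term.var i) (Language.Term.var j)).Realize v ↔ _ :=
    Language.Formula.realize_rel₂
  rw [Set.mem_ofPred_eq, Set.mem_ofPred_eq, this]
  rfl

theorem definable_mem {f g : (α → J2) → J2} (hf : J2DefinableFun f) (hg : J2DefinableFun g) :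
    J2Definable {v : α → J2 | (f v : ZFSet.{0}) ∈ (g v : ZFSet.{0})} := by
  have hF : Set.DefinableMap setLanguage Set.univ (fun v => ![f v, g v]) := by
    simp [Set.DefinableMap, *]
  exact (definable_mem_var (0 : Fin 2) 1).preimage_map hF

theorem definable_forall {S : (α → J2) → J2 → Prop}
    (h : J2Definable {w : Option α → J2 | S (w ∘ some) (w none)}) :
    J2Definable {v : α → J2 | ∀ u, S v u} := by
  have := (h.preimage_comp (fun o : Option α => o.elim (Sum.inr ()) Sum.inl)).forall_of_finite
  convert! this using 1
  ext v
  constructor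
  · intro h u
    exact h (u ())
  · intro h u
    exact h fun _ => u

theorem definable_exists {S : (α → J2) → J2 → Prop}
    (h : J2Definable {w : Option α → J2 | S (w ∘ some) (w none)}) :
    J2Definable {v : α → J2 | ∃ u, S v u} := by
  have := (h.preimage_comp (fun o : Option α => o.elim (Sum.inr ()) Sum.inl)).exists_of_finite
  convert! this using 1
  ext v
  constructor
  · rintro ⟨u, h⟩
    exact ⟨fun _ => u, h⟩
  · rintro ⟨u, h⟩
    exact ⟨u (), h⟩

/-- By extensionality the graph says that both sides have the same elements, and by transitivity of
`J2` it is enough to let these elements range over `J2`. -/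
theorem definableFun_of_mem {f : (α → J2) → J2}
    (h : J2Definable {w : Option α → J2 | (w none : ZFSet.{0}) ∈ (f (w ∘ some) : ZFSet.{0})}) :
    J2DefinableFun f := by
  have h' : J2Definable {w : Option α → J2 | ∀ u : J2, ((u : ZFSet.{0}) ∈ (w none : ZFSet.{0}) ↔
      (u : ZFSet.{0}) ∈ (f (w ∘ some) : ZFSet.{0}))} := by
    refine definable_forall (S := fun w u => ((u : ZFSet.{0}) ∈ (w none : ZFSet.{0}) ↔
      (u : ZFSet.{0}) ∈ (f (w ∘ some) : ZFSet.{0}))) ?_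
    have h₁ := definable_mem_var (none : Option (Option α)) (some none)
    have h₂ := h.preimage_comp (fun o : Option α => o.elim none fun a => some (some a))
    convert! (h₁.inter h₂).union (h₁.compl.inter h₂.compl) using 1
    ext w
    simp only [Set.mem_ofPred_eq, Set.mem_union, Set.mem_inter_iff, Set.mem_compl_iff,
      Set.mem_preimage]
    exact iff_iff_and_or_not_and_not
  change J2Definable _
  convert! h' using 1
  ext w
  simp only [Function.tupleGraph, Set.mem_ofPred_eq]
  constructor
  · rintro h u
    rw [← h]
  · intro h
    refine Subtype.ext (ZFSet.ext fun z => ⟨fun hz => ?_, fun hz => ?_⟩)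
    · exact (h ⟨z, mem_J2_of_mem hz (f (w ∘ some)).2⟩).2 hz
    · exact (h ⟨z, mem_J2_of_mem hz (w none).2⟩).1 hz

/-- The rudimentary function described by a term, on `J₂`. -/
def evalJ2 {k : ℕ} (t : RudTerm k) (v : Fin k → J2) : J2 :=
  ⟨t.eval fun i => v i, mem_J2_of_isRudimentary t fun i => (v i).2⟩

/-- In each clause, membership in the value is a first-order condition on the values of the parts.
For the union scheme the quantifier over elements of an argument becomes one over `J2`, which is
transitive. -/
theorem definableFun_evalJ2 {k : ℕ} (t : RudTerm k) : J2DefinableFun (evalJ2 t) := by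
  induction t with
  | proj i => exact Set.DefinableFun.proj _
  | @upair n i j =>
    refine definableFun_of_mem ?_
    have h₁ : J2Definable {w : Option (Fin n) → J2 | w none = w (some i)} :=
      Set.DefinableFun.ofPred_eq (.proj _) (.proj _)
    have h₂ : J2Definable {w : Option (Fin n) → J2 | w none = w (some j)} :=
      Set.DefinableFun.ofPred_eq (.proj _) (.proj _)
    convert! h₁.union h₂ using 1
    ext w
    simp only [evalJ2, RudTerm.eval, Set.mem_ofPred_eq, Set.mem_union, ZFSet.mem_pair,
      Function.comp]
    rw [Subtype.ext_iff, Subtype.ext_iff]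
  | @diff n i j =>
    refine definableFun_of_mem ?_
    convert! (definable_mem_var (none : Option (Fin n)) (some i)).inter
      (definable_mem_var (none : Option (Fin n)) (some j)).compl using 1
    ext w
    simp [evalJ2, RudTerm.eval]
  | comp G H ihG ihH =>
    exact Set.DefinableFun.comp (g := fun v i => evalJ2 (H i) v) ihH ihG
  | @union n H ih =>
    refine definableFun_of_mem ?_
    have h₁ := definable_mem_var (none : Option (Option (Fin (n + 1)))) (some (some 0))
    have h₂ : J2DefinableFun fun w : Option (Option (Fin (n + 1))) → J2 =>
        evalJ2 H (Fin.cons (w none) fun i => w (some (some i.succ))) := by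
      refine Set.DefinableFun.comp (fun i => ?_) ih
      refine Fin.cases ?_ (fun i => ?_) i
      · exact Set.DefinableFun.proj _
      · exact Set.DefinableFun.proj _
    have h₃ := h₁.inter (definable_mem (f := fun w => w (some none)) (Set.DefinableFun.proj _) h₂)
    convert! definable_exists (S := fun (w : Option (Fin (n + 1)) → J2) y =>
      (y : ZFSet.{0}) ∈ (w (some 0) : ZFSet.{0}) ∧ (w none : ZFSet.{0}) ∈
        (evalJ2 H (Fin.cons y fun i => w (some i.succ)) : ZFSet.{0})) h₃ using 1
    ext w
    simp only [evalJ2, RudTerm.eval, Set.mem_ofPred_eq]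
    rw [ZFSet.mem_iUnion]
    constructor
    · rintro ⟨⟨y, hy⟩, h⟩
      refine ⟨⟨y, mem_J2_of_mem hy (w (some 0)).2⟩, hy, ?_⟩
      convert! h using 2
      funext i
      refine Fin.cases ?_ (fun i => ?_) i <;> rfl
    · rintro ⟨y, hy, h⟩
      refine ⟨⟨y, hy⟩, ?_⟩
      convert! h using 2
      funext i
      refine Fin.cases ?_ (fun i => ?_) i <;> rfl

/-- The truth value of `P` is a definable function on `J2`, and `P` holds exactly where `∅` belongs
to it. -/
protected theorem IotaFun.definable {P : ZFSet.{0} → Prop} (hP : IotaFun P) :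
    (Set.univ : Set J2).Definable₁ setLanguage {a : J2 | P a} := by
  obtain ⟨F, ⟨k, t, a, hF⟩, h⟩ := hP
  have h₁ : J2DefinableFun fun v : Fin 1 → J2 =>
      evalJ2 t fun i => Sum.elim (fun _ => v 0) (fun c => c) (a i) := by
    refine Set.DefinableFun.comp (fun i => ?_) (definableFun_evalJ2 t)
    rcases a i with n | c
    · exact Set.DefinableFun.proj _
    · exact setLanguage.definableFun_const _ (Set.mem_univ c)
  change J2Definable _
  convert! definable_mem (f := fun _ => ⟨∅, empty_mem_J2⟩)
    (setLanguage.definableFun_const _ (Set.mem_univ _)) h₁ using 1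
  ext v
  have : (evalJ2 t fun i => Sum.elim (fun _ => v 0) (fun c => c) (a i) : ZFSet.{0}) = truth (P (v 0)) := by
    rw [← code_Prop, h, hF]
    simp only [evalJ2]
    congr 1
    funext i
    rcases a i with n | c <;> rfl
  change P (v 0) ↔ ∅ ∈ (evalJ2 t fun i => Sum.elim (fun _ => v 0) (fun c => c) (a i) : ZFSet.{0})
  rw [this]
  simp

end

/-- A subclass of `J₂` given by a rudimentary relation is an ι-class. -/
protected theorem IotaFun.isIotaClass {X : Set ZFSet.{0}} {P : ZFSet.{0} → Prop} (hP : IotaFun P)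
    (h : ∀ x, x ∈ X ↔ x ∈ J2 ∧ P x) : IsIotaClass X := by
  refine ⟨⟨fun a ha => ((h a).1 ha).1, ?_⟩, fun z hz => ?_⟩
  · convert! hP.definable using 1
    ext a
    simp [h]
  · have hs : IotaFun fun z : ZFSet.{0} => z.sep P := by fun_prop
    have : z.sep (fun a => a ∈ X) = z.sep P := by
      ext y
      simp only [ZFSet.mem_sep, h]
      exact ⟨fun hy => ⟨hy.1, hy.2.2⟩, fun hy => ⟨hy.1, mem_J2_of_mem hy.1 hz, hy.2⟩⟩
    rw [this]
    exact hs.mem_J2 hz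

/-! ## Every ι-set is covered by a rudimentary image of `J₁` -/

instance : IotaType J1 := ⟨Subtype.val, Subtype.val_injective⟩

instance : IotaSetType J1 := ⟨J1, J1_mem_J2, fun z => ⟨fun h => ⟨⟨z, h⟩, rfl⟩, by
  rintro ⟨c, rfl⟩; exact c.2⟩⟩

theorem upair_mem_J1 {a b : ZFSet.{0}} (ha : a ∈ J1) (hb : b ∈ J1) : {a, b} ∈ J1 :=
  isRudClosed_rudClosure ∅ 2 _ ⟨.upair 0 1, rfl⟩ ![a, b] fun i => by fin_cases i <;> assumption

theorem singleton_mem_J1 {a : ZFSet.{0}} (ha : a ∈ J1) : {a} ∈ J1 := by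
  simpa using upair_mem_J1 ha ha

theorem pair_mem_J1 {a b : ZFSet.{0}} (ha : a ∈ J1) (hb : b ∈ J1) : ZFSet.pair a b ∈ J1 :=
  upair_mem_J1 (singleton_mem_J1 ha) (upair_mem_J1 ha hb)

theorem union_mem_J1 {a b : ZFSet.{0}} (ha : a ∈ J1) (hb : b ∈ J1) : a ∪ b ∈ J1 := by
  have := isRudClosed_rudClosure ∅ 1 _ ⟨.union (.proj 0), rfl⟩ ![{a, b}]
    fun i => by fin_cases i; exact upair_mem_J1 ha hb
  convert! this using 1
  ext z
  simp only [RudTerm.eval]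
  rw [ZFSet.mem_iUnion]
  simp

theorem insert_mem_J1 {a b : ZFSet.{0}} (ha : a ∈ J1) (hb : b ∈ J1) : insert a b ∈ J1 := by
  rw [ZFSet.insert_eq]
  exact union_mem_J1 (singleton_mem_J1 ha) hb

/-- Ordered pairs in `J₁`. -/
def pairJ1 (s t : J1) : J1 := ⟨ZFSet.pair s t, pair_mem_J1 s.2 t.2⟩

open Classical in
/-- The element `x` of `J₁`, and `∅` if `x` is not in `J₁`. -/
def toJ1 (x : ZFSet.{0}) : J1 := if h : x ∈ J1 then ⟨x, h⟩ else ⟨∅, empty_mem_J1⟩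

/-- The first component of an ordered pair in `J₁`. -/
def fstJ1 (s : J1) : J1 := toJ1 (rudFst s)

/-- The second component of an ordered pair in `J₁`. -/
def sndJ1 (s : J1) : J1 := toJ1 (rudSnd s)

@[simp] theorem toJ1_coe (s : J1) : toJ1 s = s := by simp [toJ1]

@[simp] theorem fstJ1_pairJ1 (s t : J1) : fstJ1 (pairJ1 s t) = s := by simp [fstJ1, pairJ1]

@[simp] theorem sndJ1_pairJ1 (s t : J1) : sndJ1 (pairJ1 s t) = t := by simp [sndJ1, pairJ1]

section

variable {α : Type*} [IotaType α]

@[fun_prop]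
protected theorem IotaFun.J1 : IotaFun (fun _ : α => J1) := .const_of_mem J1_mem_J2

@[fun_prop]
protected theorem IotaFun.coe_J1 {f : α → J1} (hf : IotaFun f) :
    IotaFun (fun a => (f a : ZFSet.{0})) := hf

@[fun_prop]
protected theorem IotaFun.pairJ1 {f g : α → J1} (hf : IotaFun f) (hg : IotaFun g) :
    IotaFun (fun a => pairJ1 (f a) (g a)) :=
  (by fun_prop : IotaFun fun a => ZFSet.pair (f a) (g a))

@[fun_prop]
protected theorem IotaFun.toJ1 {f : α → ZFSet.{0}} (hf : IotaFun f) : IotaFun (fun a => toJ1 (f a)) := by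
  classical
  exact (by fun_prop : IotaFun fun a => if f a ∈ J1 then f a else ∅).congr fun a => by
    by_cases h : f a ∈ J1 <;> simp [toJ1, h]

@[fun_prop]
protected theorem IotaFun.rudFst {f : α → ZFSet.{0}} (hf : IotaFun f) : IotaFun (fun a => rudFst (f a)) :=
  IotaFun.comp (f := rudFst) ⟨_, IotaRud.rudFst, fun _ => rfl⟩ hf

@[fun_prop]
protected theorem IotaFun.rudSnd {f : α → ZFSet.{0}} (hf : IotaFun f) : IotaFun (fun a => rudSnd (f a)) :=
  IotaFun.comp (f := rudSnd) ⟨_, IotaRud.rudSnd, fun _ => rfl⟩ hf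

@[fun_prop]
protected theorem IotaFun.fstJ1 {f : α → J1} (hf : IotaFun f) :
    IotaFun (fun a => fstJ1 (f a)) := by
  unfold fstJ1; fun_prop

@[fun_prop]
protected theorem IotaFun.sndJ1 {f : α → J1} (hf : IotaFun f) :
    IotaFun (fun a => sndJ1 (f a)) := by
  unfold sndJ1; fun_prop

protected theorem IotaFun.eval {k : ℕ} (t : RudTerm k) {g : Fin k → α → ZFSet.{0}}
    (hg : ∀ i, IotaFun (g i)) : IotaFun (fun a => t.eval fun i => g i a) := by
  choose G hG h using hg
  refine ⟨_, IotaRud.eval t hG, fun a => ?_⟩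
  simp only [← h]
  rfl

end

/-- `h'` enumerates, uniformly in `s`, the elements of `h s`. -/
def Enumerates (h' h : J1 → ZFSet.{0}) : Prop := ∀ s, ∀ y ∈ h s, ∃ t, y = h' (pairJ1 s t)

/-- Rudimentary functions on `J₁` all of whose values are hereditarily enumerated by rudimentary
functions on `J₁`. -/
def IsCovered (h : J1 → ZFSet.{0}) : Prop :=
  -- A coinductive definition: an enumerating function must itself have an enumerating function, and
  -- so on. One level would not suffice, since the union scheme passes from elements to elements of
  -- elements.
  ∃ G : Set (J1 → ZFSet.{0}), h ∈ G ∧ ∀ h ∈ G, IotaFun h ∧ ∃ h' ∈ G, Enumerates h' h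

namespace IsCovered

variable {h : J1 → ZFSet.{0}}

theorem iotaFun (hh : IsCovered h) : IotaFun h := by
  obtain ⟨G, hG, H⟩ := hh
  exact (H h hG).1

theorem exists_enumerates (hh : IsCovered h) : ∃ h', IsCovered h' ∧ Enumerates h' h := by
  obtain ⟨G, hG, H⟩ := hh
  obtain ⟨-, h', hG', he⟩ := H h hG
  exact ⟨h', ⟨G, hG', H⟩, he⟩

/-- Coinduction up to covered functions. -/
theorem coinduction (G : Set (J1 → ZFSet.{0})) (hh : h ∈ G)
    (H : ∀ h ∈ G, IotaFun h ∧ ∃ h', (h' ∈ G ∨ IsCovered h') ∧ Enumerates h' h) :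
    IsCovered h := by
  refine ⟨G ∪ {h | IsCovered h}, .inl hh, ?_⟩
  rintro h (hh | hh)
  · exact H h hh
  · obtain ⟨h', hh', he⟩ := exists_enumerates hh
    exact ⟨iotaFun hh, h', .inr hh', he⟩

theorem of_enumerates (hf : IotaFun h) {h' : J1 → ZFSet.{0}} (hh' : IsCovered h')
    (he : Enumerates h' h) : IsCovered h := by
  refine coinduction {h} rfl ?_
  rintro _ rfl
  exact ⟨hf, h', .inr hh', he⟩

/-- All elements of values lie in `J1` and so can serve as their own indices. By transitivity of
`J1` the enumerating function again has subsets of `J1` as values. -/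
theorem of_subset_J1 (hf : IotaFun h) (hh : ∀ s, h s ⊆ J1) : IsCovered h := by
  refine coinduction {h | IotaFun h ∧ ∀ s, h s ⊆ J1} ⟨hf, hh⟩ ?_
  rintro h ⟨hf, hh⟩
  refine ⟨hf, fun s => sndJ1 s, .inl ⟨by fun_prop, fun s => ?_⟩, fun s y hy => ?_⟩
  · exact isTransitive_J1 _ (sndJ1 s).2
  · exact ⟨⟨y, hh s hy⟩, by simp⟩

theorem comp (hh : IsCovered h) {p : J1 → J1} (hp : IotaFun p) : IsCovered fun s => h (p s) := by
  refine coinduction {g | ∃ h p, IsCovered h ∧ IotaFun p ∧ g = fun s => h (p s)}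
    ⟨h, p, hh, hp, rfl⟩ ?_
  rintro _ ⟨h, p, hh, hp, rfl⟩
  obtain ⟨h', hh', he⟩ := hh.exists_enumerates
  have := hh.iotaFun
  refine ⟨by fun_prop, _, .inl ⟨h', fun t => pairJ1 (p (fstJ1 t)) (sndJ1 t), hh', by fun_prop,
    rfl⟩, fun s y hy => ?_⟩
  obtain ⟨t, rfl⟩ := he _ y hy
  exact ⟨t, by simp⟩

open Classical in
theorem ite {P : J1 → Prop} {h₁ h₂ : J1 → ZFSet.{0}} (hP : IotaFun P) (hh₁ : IsCovered h₁)
    (hh₂ : IsCovered h₂) : IsCovered fun s => if P s then h₁ s else h₂ s := by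
  refine coinduction {g | ∃ (P : J1 → Prop) (h₁ h₂ : J1 → ZFSet.{0}), IotaFun P ∧ IsCovered h₁ ∧
    IsCovered h₂ ∧ g = fun s => if P s then h₁ s else h₂ s} ⟨P, h₁, h₂, hP, hh₁, hh₂, rfl⟩ ?_
  rintro _ ⟨P, h₁, h₂, hP, hh₁, hh₂, rfl⟩
  obtain ⟨h₁', hh₁', he₁⟩ := hh₁.exists_enumerates
  obtain ⟨h₂', hh₂', he₂⟩ := hh₂.exists_enumerates
  have := hh₁.iotaFun
  have := hh₂.iotaFun
  refine ⟨by fun_prop, _, .inl ⟨fun t => P (fstJ1 t), h₁', h₂', by fun_prop, hh₁', hh₂', rfl⟩,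
    fun s y hy => ?_⟩
  by_cases hs : P s
  · obtain ⟨t, rfl⟩ := he₁ s y (by simpa [hs] using hy)
    exact ⟨t, by simp [hs]⟩
  · obtain ⟨t, rfl⟩ := he₂ s y (by simpa [hs] using hy)
    exact ⟨t, by simp [hs]⟩

/-- Induction on the term. For a pair, the index decides which of the two components is meant; for a
difference, the enumeration of the larger set works. For the union scheme, one index finds `y` in
the first argument and a second one finds an element of the value of `H` at `y`. -/
theorem eval {k : ℕ} (t : RudTerm k) {h : Fin k → J1 → ZFSet.{0}} (hh : ∀ i, IsCovered (h i)) :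
    IsCovered fun s => t.eval fun i => h i s := by
  classical
  induction t with
  | proj i => exact hh i
  | upair i j =>
    have hi := hh i
    have hj := hh j
    refine of_enumerates (IotaFun.eval _ fun i => (hh i).iotaFun) (ite
      (P := fun u => (sndJ1 u : ZFSet.{0}) = ∅) (by fun_prop) (hi.comp (p := fstJ1) (by fun_prop))
      (hj.comp (p := fstJ1) (by fun_prop))) fun s y hy => ?_
    rcases ZFSet.mem_pair.1 hy with rfl | rfl
    · exact ⟨⟨∅, empty_mem_J1⟩, by simp⟩
    · have h₁ : ({∅} : ZFSet.{0}) ≠ ∅ := by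
        rw [Ne, ZFSet.eq_empty]; simp
      exact ⟨⟨{∅}, singleton_mem_J1 empty_mem_J1⟩, by simp [h₁]⟩
  | diff i j =>
    obtain ⟨h', hh', he⟩ := (hh i).exists_enumerates
    exact of_enumerates (IotaFun.eval _ fun i => (hh i).iotaFun) hh'
      fun s y hy => he s y (ZFSet.mem_sdiff.1 hy).1
  | comp G H ihG ihH => exact ihG fun i => ihH i hh
  | union H ih =>
    obtain ⟨h', hh', he⟩ := (hh 0).exists_enumerates
    obtain ⟨K, hK, hK'⟩ := (ih (h := Fin.cons h' fun i u => h i.succ (fstJ1 u)) fun i => by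
      refine Fin.cases hh' (fun i => ?_) i
      exact (hh i.succ).comp (p := fstJ1) (by fun_prop)).exists_enumerates
    refine of_enumerates (IotaFun.eval _ fun i => (hh i).iotaFun) (hK.comp
      -- An index `(s, (t, t'))` is regrouped as `((s, t), t')`: here `h'` at `(s, t)` is the
      -- element of the first argument, and `t'` picks an element of the value of `H` there.
      (p := fun u => pairJ1 (pairJ1 (fstJ1 u) (fstJ1 (sndJ1 u))) (sndJ1 (sndJ1 u)))
      (by fun_prop)) fun s y hy => ?_
    simp only [RudTerm.eval] at hy
    obtain ⟨⟨w, hw⟩, hy⟩ := ZFSet.mem_iUnion.1 hy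
    obtain ⟨t, rfl⟩ := he s w hw
    obtain ⟨t', rfl⟩ := hK' (pairJ1 s t) y (by
      convert! hy using 2
      funext i
      refine Fin.cases rfl (fun i => ?_) i
      simp [Fin.tail])
    exact ⟨pairJ1 t t', by simp⟩

end IsCovered

/-- Every ι-set is covered by the image of `J₁` under a rudimentary function. -/
theorem exists_cover {z : ZFSet.{0}} (hz : z ∈ J2) :
    ∃ h : J1 → ZFSet.{0}, IotaFun h ∧ ∀ y ∈ z, ∃ s, y = h s := by
  obtain ⟨n, t, v, hv, rfl⟩ := mem_rudClosure.1 hz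
  obtain ⟨h, hh, he⟩ := (IsCovered.eval t (h := fun i _ => v i) fun i => by
    rcases ZFSet.mem_insert_iff.1 (hv i) with h | h
    · exact .of_subset_J1 (.const_of_mem (h ▸ J1_mem_J2)) fun _ => h ▸ subset_rfl
    · exact .of_subset_J1 (.const_of_mem (J1_subset_J2 h)) fun _ =>
        isTransitive_J1 _ h).exists_enumerates
  refine ⟨h, hh.iotaFun, fun y hy => ?_⟩
  -- The parameters are constant functions on `J1`, so any index would do in place of `∅`.
  obtain ⟨s, hs⟩ := he ⟨∅, empty_mem_J1⟩ y hy
  exact ⟨_, hs⟩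

/-! ## Natural numbers -/

theorem mem_natCode {x : ZFSet.{0}} {n : ℕ} : x ∈ natCode n ↔ ∃ m < n, x = natCode m := by
  induction n with
  | zero => simp [natCode]
  | succ n ih =>
    simp only [natCode, ZFSet.mem_insert_iff, ih, Nat.lt_succ_iff_lt_or_eq]
    constructor
    · rintro (rfl | ⟨m, hm, rfl⟩)
      · exact ⟨n, .inr rfl, rfl⟩
      · exact ⟨m, .inl hm, rfl⟩
    · rintro ⟨m, hm | rfl, rfl⟩
      · exact .inr ⟨m, hm, rfl⟩
      · exact .inl rfl

theorem natCode_injective : Function.Injective natCode := by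
  intro m n h
  rcases lt_trichotomy m n with hmn | hmn | hmn
  · have : natCode m ∈ natCode n := mem_natCode.2 ⟨m, hmn, rfl⟩
    exact (ZFSet.mem_irrefl _ (h ▸ this)).elim
  · exact hmn
  · have : natCode n ∈ natCode m := mem_natCode.2 ⟨n, hmn, rfl⟩
    exact (ZFSet.mem_irrefl _ (h ▸ this)).elim

instance : IotaType ℕ := ⟨natCode, natCode_injective⟩

theorem code_nat_mem_J1 (n : ℕ) : code n ∈ J1 := by
  induction n with
  | zero => exact empty_mem_J1
  | succ n ih => exact insert_mem_J1 ih ih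

/-- Transitive sets `x` such that `x` and its elements are `∅` or successors. -/
def IsNatural (x : ZFSet.{0}) : Prop :=
  (¬ ∃ y ∈ x, ¬ y ⊆ x) ∧ ¬ ∃ m ∈ insert x x, ¬ (m = ∅ ∨ ∃ k ∈ m, m = insert k k)

theorem isNatural_iff {x : ZFSet.{0}} : IsNatural x ↔ ∃ n : ℕ, code n = x := by
  unfold IsNatural
  push Not
  constructor
  · refine ZFSet.inductionOn x fun x ih ⟨ht, hx⟩ => ?_
    rcases hx x (ZFSet.mem_insert _ _) with rfl | ⟨k, hk, hxk⟩
    · exact ⟨0, rfl⟩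
    -- The predecessor is transitive too: `z = k` would give `k ∈ y ∈ k`, against foundation.
    · have hkt : ∀ y ∈ k, y ⊆ k := fun y hy z hz => by
        have hzx : z ∈ x := ht y (ht k hk hy) hz
        rw [hxk] at hzx
        rcases ZFSet.mem_insert_iff.1 hzx with rfl | h
        · exact (ZFSet.mem_asymm hy hz).elim
        · exact h
      obtain ⟨n, rfl⟩ := ih k hk ⟨hkt, fun m hm =>
        hx m (ZFSet.mem_insert_of_mem _ (by rwa [← hxk] at hm))⟩
      exact ⟨n + 1, hxk.symm⟩
  · rintro ⟨n, rfl⟩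
    refine ⟨fun y hy z hz => ?_, fun m hm => ?_⟩
    · obtain ⟨m, hm, rfl⟩ := mem_natCode.1 hy
      obtain ⟨k, hk, rfl⟩ := mem_natCode.1 hz
      exact mem_natCode.2 ⟨k, hk.trans hm, rfl⟩
    · obtain ⟨k, -, rfl⟩ := mem_natCode.1 (show m ∈ natCode (n + 1) from hm)
      cases k with
      | zero => exact .inl rfl
      | succ k => exact .inr ⟨natCode k, ZFSet.mem_insert _ _, rfl⟩

/-- The quantifiers in `IsNatural` are bounded by its argument, so ℕ arises from `J1` by a
rudimentary separation. -/
instance : IotaSetType ℕ := by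
  have h : IotaFun fun x : ZFSet.{0} => x.sep IsNatural := by
    unfold IsNatural; fun_prop
  refine ⟨_, h.mem_J2 (a := J1) J1_mem_J2, fun z => ?_⟩
  simp only [code_ZFSet, ZFSet.mem_sep, isNatural_iff, and_iff_right_iff_imp]
  rintro ⟨n, rfl⟩
  exact code_nat_mem_J1 n

/-- Functions defined by primitive recursion from rudimentary functions are rudimentary. -/
protected theorem IotaFun.natRec {b : ℕ → ℕ} {G F : ℕ → ℕ → ℕ} (hb : IotaFun b)
    (hG : IotaFun fun p : ℕ × ℕ => G p.1 p.2) (h0 : ∀ m, F m 0 = b m)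
    (hs : ∀ m n, F m (n + 1) = G m (F m n)) : IotaFun fun p : ℕ × ℕ => F p.1 p.2 := by
  have hsucc : IotaFun Nat.succ :=
    (by fun_prop : IotaFun fun n : ℕ => insert (code n) (code n))
  -- `C c` says that `c` is a partial computation of `F`: each recorded value is an initial value or
  -- follows by one step from another recorded value. Finite computations belong to `J1`, so the
  -- quantifier over `c` is bounded.
  let C : J1 → Prop := fun c => ∀ m n k : ℕ, code ((m, n), k) ∈ (c : ZFSet.{0}) →
    (n = 0 ∧ k = b m) ∨ ∃ n' k' : ℕ, n = n'.succ ∧ k = G m k' ∧ code ((m, n'), k') ∈ (c : ZFSet.{0})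
  have hC : IotaFun C := by fun_prop
  refine IotaFun.of_graph ((by fun_prop : IotaFun fun p : (ℕ × ℕ) × ℕ =>
    ∃ c, C c ∧ code ((p.1.1, p.1.2), p.2) ∈ (c : ZFSet.{0})).congr ?_)
  rintro ⟨⟨m, n⟩, k⟩
  refine propext ⟨?_, ?_⟩ <;> dsimp only
  · rintro rfl
    induction n with
    | zero =>
      have hmem : code ((m, 0), F m 0) ∈ J1 :=
        pair_mem_J1 (pair_mem_J1 (code_nat_mem_J1 _) (code_nat_mem_J1 _)) (code_nat_mem_J1 _)
      refine ⟨⟨_, singleton_mem_J1 hmem⟩, fun m' n' k' h => .inl ?_, by simp⟩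
      have := IotaType.code_injective (ZFSet.mem_singleton.1 h)
      simp only [Prod.mk.injEq] at this
      obtain ⟨⟨rfl, rfl⟩, rfl⟩ := this
      exact ⟨rfl, h0 _⟩
    | succ n ih =>
      obtain ⟨⟨c, hc⟩, h, h'⟩ := ih
      have hmem : code ((m, n + 1), F m (n + 1)) ∈ J1 :=
        pair_mem_J1 (pair_mem_J1 (code_nat_mem_J1 _) (code_nat_mem_J1 _)) (code_nat_mem_J1 _)
      refine ⟨⟨_, insert_mem_J1 hmem hc⟩, fun m' n' k' hk => ?_, ZFSet.mem_insert _ _⟩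
      rcases ZFSet.mem_insert_iff.1 hk with hk | hk
      · have := IotaType.code_injective hk
        simp only [Prod.mk.injEq] at this
        obtain ⟨⟨rfl, rfl⟩, rfl⟩ := this
        exact .inr ⟨n, F m' n, rfl, hs _ _, ZFSet.mem_insert_of_mem _ h'⟩
      · rcases h m' n' k' hk with h | ⟨n'', k'', rfl, rfl, hk'⟩
        · exact .inl h
        · exact .inr ⟨n'', k'', rfl, rfl, ZFSet.mem_insert_of_mem _ hk'⟩
  · rintro ⟨c, hc, h⟩
    induction n generalizing k with
    | zero =>
      rcases hc m 0 k h with ⟨-, rfl⟩ | ⟨n', k', h', -⟩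
      · exact h0 m
      · cases h'
    | succ n ih =>
      rcases hc m (n + 1) k h with ⟨h', -⟩ | ⟨n', k', h', rfl, hk⟩
      · cases h'
      · cases h'
        rw [hs, ih k' hk]

section

variable {α : Type*} [IotaType α]

@[fun_prop]
protected theorem IotaFun.natAdd {f g : α → ℕ} (hf : IotaFun f) (hg : IotaFun g) :
    IotaFun (fun a => f a + g a) := by
  have hsucc : IotaFun fun p : ℕ × ℕ => p.2.succ :=
    (by fun_prop : IotaFun fun p : ℕ × ℕ => insert (code p.2) (code p.2))
  have h := IotaFun.natRec (b := fun m => m) (G := fun _ k => k.succ) (F := fun m n => m + n)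
    (by fun_prop) hsucc (fun _ => rfl) (fun _ _ => rfl)
  exact h.comp (hf.prodMk hg)

@[fun_prop]
protected theorem IotaFun.natMul {f g : α → ℕ} (hf : IotaFun f) (hg : IotaFun g) :
    IotaFun (fun a => f a * g a) := by
  have h := IotaFun.natRec (b := fun m => 0) (G := fun m k => k + m) (F := fun m n => m * n)
    (by fun_prop) (by fun_prop) (fun _ => rfl) (fun _ _ => rfl)
  exact h.comp (hf.prodMk hg)

end

/-! ## Integers -/

theorem mem_intCode {x : ZFSet.{0}} {z : ℤ} :
    x ∈ intCode z ↔ ∃ m n : ℕ, (m : ℤ) - n = z ∧ x = code (m, n) := by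
  simp only [intCode, ZFSet.mem_range, Subtype.exists, Prod.exists]
  exact ⟨fun ⟨m, n, h, hx⟩ => ⟨m, n, h, hx.symm⟩, fun ⟨m, n, h, hx⟩ => ⟨m, n, h, hx.symm⟩⟩

theorem code_mem_intCode {m n : ℕ} {z : ℤ} : code (m, n) ∈ intCode z ↔ (m : ℤ) - n = z := by
  rw [mem_intCode]
  constructor
  · rintro ⟨m', n', h, h'⟩
    cases IotaType.code_injective h'
    exact h
  · exact fun h => ⟨m, n, h, rfl⟩

theorem exists_code_mem_intCode (z : ℤ) : ∃ m n : ℕ, code (m, n) ∈ intCode z := by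
  refine ⟨z.toNat, (-z).toNat, code_mem_intCode.2 ?_⟩
  omega

theorem intCode_injective : Function.Injective intCode := by
  intro z z' h
  obtain ⟨m, n, hz⟩ := exists_code_mem_intCode z
  have hz' := hz
  rw [h, code_mem_intCode] at hz'
  rw [← hz', code_mem_intCode.1 hz]

instance : IotaType ℤ := ⟨intCode, intCode_injective⟩

theorem code_mem_code_int {m n : ℕ} {z : ℤ} : code (m, n) ∈ code z ↔ (m : ℤ) - n = z :=
  code_mem_intCode

/-- Equality of differences is stated additively within ℕ. The block is separated directly from the
pairs of naturals; `IotaFun.of_graph` is not applicable, since it needs the ι-set of integers, which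
is obtained as the range of this function. -/
theorem iotaFun_natSub : IotaFun fun p : ℕ × ℕ => (p.1 : ℤ) - p.2 := by
  refine (by fun_prop : IotaFun fun p : ℕ × ℕ => (codes (ℕ × ℕ)).sep fun x =>
    ∃ m n : ℕ, x = code (m, n) ∧ m + p.2 = p.1 + n).congr (g := fun p : ℕ × ℕ =>
      code ((p.1 : ℤ) - p.2)) fun p => ?_
  ext x
  change x ∈ intCode _ ↔ _
  rw [mem_intCode, ZFSet.mem_sep]
  constructor
  · rintro ⟨m, n, h, rfl⟩
    exact ⟨code_mem_codes _, m, n, rfl, by omega⟩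
  · rintro ⟨-, m, n, rfl, h⟩
    exact ⟨m, n, by omega, rfl⟩

instance : IotaSetType ℤ := by
  obtain ⟨s, hs, h⟩ := iotaFun_natSub.exists_range
  refine ⟨s, hs, fun z => (h z).trans ⟨?_, ?_⟩⟩
  · rintro ⟨p, rfl⟩
    exact ⟨_, rfl⟩
  · rintro ⟨c, rfl⟩
    obtain ⟨m, n, hc⟩ := exists_code_mem_intCode c
    exact ⟨(m, n), by rw [code_mem_intCode.1 hc]⟩

section

variable {α : Type*} [IotaType α]

@[fun_prop]
protected theorem IotaFun.natCast_int {f : α → ℕ} (hf : IotaFun f) :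
    IotaFun (fun a => (f a : ℤ)) :=
  (iotaFun_natSub.comp (hf.prodMk (.const 0))).congr fun a => by simp

@[fun_prop]
protected theorem IotaFun.intAdd {f g : α → ℤ} (hf : IotaFun f) (hg : IotaFun g) :
    IotaFun (fun a => f a + g a) := by
  refine IotaFun.of_graph ((by fun_prop : IotaFun fun p : α × ℤ => ∃ m n m' n' : ℕ,
    code (m, n) ∈ code (f p.1) ∧ code (m', n') ∈ code (g p.1) ∧
      code (m + m', n + n') ∈ code p.2).congr fun p => propext ?_)
  simp only [code_mem_code_int]
  constructor
  · intro h
    obtain ⟨m, n, hf⟩ := exists_code_mem_intCode (f p.1)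
    obtain ⟨m', n', hg⟩ := exists_code_mem_intCode (g p.1)
    rw [code_mem_intCode] at hf hg
    exact ⟨m, n, m', n', hf, hg, by push_cast; linarith⟩
  · rintro ⟨m, n, m', n', hf, hg, h⟩
    push_cast at h
    linarith

@[fun_prop]
protected theorem IotaFun.intMul {f g : α → ℤ} (hf : IotaFun f) (hg : IotaFun g) :
    IotaFun (fun a => f a * g a) := by
  refine IotaFun.of_graph ((by fun_prop : IotaFun fun p : α × ℤ => ∃ m n m' n' : ℕ,
    code (m, n) ∈ code (f p.1) ∧ code (m', n') ∈ code (g p.1) ∧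
      code (m * m' + n * n', m * n' + n * m') ∈ code p.2).congr fun p => propext ?_)
  simp only [code_mem_code_int]
  constructor
  · intro h
    obtain ⟨m, n, hf⟩ := exists_code_mem_intCode (f p.1)
    obtain ⟨m', n', hg⟩ := exists_code_mem_intCode (g p.1)
    rw [code_mem_intCode] at hf hg
    exact ⟨m, n, m', n', hf, hg, by rw [← h, ← hf, ← hg]; push_cast; ring⟩
  · rintro ⟨m, n, m', n', hf, hg, h⟩
    rw [← h, ← hf, ← hg]
    push_cast
    ring

end

/-! ## Rational numbers -/

theorem mem_ratCode {x : ZFSet.{0}} {q : ℚ} :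
    x ∈ ratCode q ↔ ∃ a b : ℤ, (b ≠ 0 ∧ (a : ℚ) / b = q) ∧ x = code (a, b) := by
  simp only [ratCode, ZFSet.mem_range, Subtype.exists, Prod.exists]
  exact ⟨fun ⟨m, n, h, hx⟩ => ⟨m, n, h, hx.symm⟩, fun ⟨m, n, h, hx⟩ => ⟨m, n, h, hx.symm⟩⟩

theorem code_mem_ratCode {a b : ℤ} {q : ℚ} :
    code (a, b) ∈ ratCode q ↔ b ≠ 0 ∧ (a : ℚ) / b = q := by
  rw [mem_ratCode]
  constructor
  · rintro ⟨m', n', h, h'⟩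
    cases IotaType.code_injective h'
    exact h
  · exact fun h => ⟨a, b, h, rfl⟩

theorem exists_code_mem_ratCode (q : ℚ) : ∃ a b : ℤ, code (a, b) ∈ ratCode q :=
  ⟨q.num, q.den, code_mem_ratCode.2 ⟨by exact_mod_cast q.den_ne_zero, by
    exact_mod_cast q.num_div_den⟩⟩

theorem ratCode_injective : Function.Injective ratCode := by
  intro q q' h
  obtain ⟨a, b, hq⟩ := exists_code_mem_ratCode q
  have hq' := hq
  rw [h, code_mem_ratCode] at hq'
  rw [← hq'.2, (code_mem_ratCode.1 hq).2]

instance : IotaType ℚ := ⟨ratCode, ratCode_injective⟩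

theorem code_mem_code_rat {a b : ℤ} {q : ℚ} :
    code (a, b) ∈ code q ↔ b ≠ 0 ∧ (a : ℚ) / b = q :=
  code_mem_ratCode

/-- Denominators are shifted by one to stay nonzero, and equality of fractions is stated by cross
multiplication. The range of this function gives the ι-set of rationals. -/
theorem iotaFun_intDiv : IotaFun fun p : ℤ × ℕ => (p.1 : ℚ) / ((p.2 + 1 : ℕ) : ℚ) := by
  refine (by fun_prop : IotaFun fun p : ℤ × ℕ => (codes (ℤ × ℤ)).sep fun x =>
    ∃ a b : ℤ, x = code (a, b) ∧ ¬ b = 0 ∧ a * ((p.2 + 1 : ℕ) : ℤ) = p.1 * b).congr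
      (g := fun p : ℤ × ℕ => code ((p.1 : ℚ) / ((p.2 + 1 : ℕ) : ℚ))) fun p => ?_
  have hp : ((p.2 + 1 : ℕ) : ℚ) ≠ 0 := by positivity
  ext x
  change x ∈ ratCode _ ↔ _
  rw [mem_ratCode, ZFSet.mem_sep]
  constructor
  · rintro ⟨a, b, ⟨hb, h⟩, rfl⟩
    refine ⟨code_mem_codes _, a, b, rfl, hb, ?_⟩
    rw [div_eq_div_iff (by exact_mod_cast hb) hp] at h
    exact_mod_cast h
  · rintro ⟨-, a, b, rfl, hb, h⟩
    refine ⟨a, b, ⟨hb, ?_⟩, rfl⟩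
    rw [div_eq_div_iff (by exact_mod_cast hb) hp]
    exact_mod_cast h

instance : IotaSetType ℚ := by
  obtain ⟨s, hs, h⟩ := iotaFun_intDiv.exists_range
  refine ⟨s, hs, fun z => (h z).trans ⟨?_, ?_⟩⟩
  · rintro ⟨p, rfl⟩
    exact ⟨_, rfl⟩
  · rintro ⟨q, rfl⟩
    refine ⟨(q.num, q.den - 1), ?_⟩
    dsimp only
    rw [Nat.sub_add_cancel q.den_pos, q.num_div_den]

section

variable {α : Type*} [IotaType α]

@[fun_prop]
protected theorem IotaFun.ratAdd {f g : α → ℚ} (hf : IotaFun f) (hg : IotaFun g) :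
    IotaFun (fun a => f a + g a) := by
  refine IotaFun.of_graph ((by fun_prop : IotaFun fun p : α × ℚ => ∃ a b a' b' : ℤ,
    code (a, b) ∈ code (f p.1) ∧ code (a', b') ∈ code (g p.1) ∧
      code (a * b' + b * a', b * b') ∈ code p.2).congr fun p => propext ?_)
  have key : ∀ a b a' b' : ℤ, code (a, b) ∈ code (f p.1) → code (a', b') ∈ code (g p.1) →
      (code (a * b' + b * a', b * b') ∈ code p.2 ↔ f p.1 + g p.1 = p.2) := by
    intro a b a' b' h h'
    rw [code_mem_code_rat] at h h' ⊢
    obtain ⟨hb, h⟩ := h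
    obtain ⟨hb', h'⟩ := h'
    have : ((a * b' + b * a' : ℤ) : ℚ) / ((b * b' : ℤ) : ℚ) = f p.1 + g p.1 := by
      rw [← h, ← h', div_add_div _ _ (by exact_mod_cast hb) (by exact_mod_cast hb')]
      push_cast
      rfl
    rw [this]
    exact and_iff_right (mul_ne_zero hb hb')
  constructor
  · intro h
    obtain ⟨a, b, hf⟩ := exists_code_mem_ratCode (f p.1)
    obtain ⟨a', b', hg⟩ := exists_code_mem_ratCode (g p.1)
    exact ⟨a, b, a', b', hf, hg, (key a b a' b' hf hg).2 h⟩
  · rintro ⟨a, b, a', b', hf, hg, h⟩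
    exact (key a b a' b' hf hg).1 h

@[fun_prop]
protected theorem IotaFun.ratMul {f g : α → ℚ} (hf : IotaFun f) (hg : IotaFun g) :
    IotaFun (fun a => f a * g a) := by
  refine IotaFun.of_graph ((by fun_prop : IotaFun fun p : α × ℚ => ∃ a b a' b' : ℤ,
    code (a, b) ∈ code (f p.1) ∧ code (a', b') ∈ code (g p.1) ∧
      code (a * a', b * b') ∈ code p.2).congr fun p => propext ?_)
  have key : ∀ a b a' b' : ℤ, code (a, b) ∈ code (f p.1) → code (a', b') ∈ code (g p.1) →
      (code (a * a', b * b') ∈ code p.2 ↔ f p.1 * g p.1 = p.2) := by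
    intro a b a' b' h h'
    rw [code_mem_code_rat] at h h' ⊢
    obtain ⟨hb, h⟩ := h
    obtain ⟨hb', h'⟩ := h'
    have : ((a * a' : ℤ) : ℚ) / ((b * b' : ℤ) : ℚ) = f p.1 * g p.1 := by
      rw [← h, ← h', div_mul_div_comm]
      push_cast
      rfl
    rw [this]
    exact and_iff_right (mul_ne_zero hb hb')
  constructor
  · intro h
    obtain ⟨a, b, hf⟩ := exists_code_mem_ratCode (f p.1)
    obtain ⟨a', b', hg⟩ := exists_code_mem_ratCode (g p.1)
    exact ⟨a, b, a', b', hf, hg, (key a b a' b' hf hg).2 h⟩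
  · rintro ⟨a, b, a', b', hf, hg, h⟩
    exact (key a b a' b' hf hg).1 h

@[fun_prop]
protected theorem IotaFun.ratNeg {f : α → ℚ} (hf : IotaFun f) : IotaFun (fun a => - f a) :=
  IotaFun.of_graph ((by fun_prop : IotaFun fun p : α × ℚ => f p.1 + p.2 = 0).congr fun p =>
    propext neg_eq_iff_add_eq_zero)

-- The order is reduced to addition: the difference has to be a fraction `(m + 1) / (n + 1)` with
-- natural `m` and `n`.
@[fun_prop]
protected theorem IotaFun.ratLT {f g : α → ℚ} (hf : IotaFun f) (hg : IotaFun g) :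
    IotaFun (fun a => f a < g a) := by
  have h : IotaFun fun p : ℕ × ℕ => (((p.1 + 1 : ℕ) : ℤ) : ℚ) / ((p.2 + 1 : ℕ) : ℚ) :=
    iotaFun_intDiv.comp (f := fun p : ℤ × ℕ => (p.1 : ℚ) / ((p.2 + 1 : ℕ) : ℚ))
      (g := fun p : ℕ × ℕ => (((p.1 + 1 : ℕ) : ℤ), p.2)) (by fun_prop)
  let D : ℕ × ℕ → ℚ := fun p => (((p.1 + 1 : ℕ) : ℤ) : ℚ) / ((p.2 + 1 : ℕ) : ℚ)
  have hD : IotaFun D := h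
  refine (by fun_prop : IotaFun fun a => ∃ m n, f a + D (m, n) = g a).congr fun a => propext ?_
  constructor
  · intro h
    have hpos : 0 < g a - f a := sub_pos.2 h
    have hnum := Rat.num_pos.2 hpos
    refine ⟨(g a - f a).num.toNat - 1, (g a - f a).den - 1, ?_⟩
    have h₁ : ((g a - f a).num.toNat - 1 + 1 : ℕ) = (g a - f a).num.toNat := by omega
    have h₂ : ((g a - f a).den - 1 + 1 : ℕ) = (g a - f a).den :=
      Nat.sub_add_cancel (g a - f a).den_pos
    have h₃ : (((g a - f a).num.toNat : ℕ) : ℤ) = (g a - f a).num := Int.toNat_of_nonneg hnum.le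
    simp only [D]
    rw [h₁, h₂, h₃, Rat.num_div_den]
    ring
  · rintro ⟨m, n, h⟩
    have : 0 < D (m, n) := by simp only [D]; positivity
    linarith

@[fun_prop]
protected theorem IotaFun.ratLE {f g : α → ℚ} (hf : IotaFun f) (hg : IotaFun g) :
    IotaFun (fun a => f a ≤ g a) :=
  (by fun_prop : IotaFun fun a => ¬ g a < f a).congr fun a => by simp

end

/-! ## ι-classes and ι-functions from rudimentary relations and functions -/

theorem pair_mem_J2_iff {a b : ZFSet.{0}} : ZFSet.pair a b ∈ J2 ↔ a ∈ J2 ∧ b ∈ J2 := by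
  constructor
  · intro h
    have h' : {a, b} ∈ J2 := mem_J2_of_mem (ZFSet.mem_pair.2 (.inr rfl)) h
    exact ⟨mem_J2_of_mem (ZFSet.mem_pair.2 (.inl rfl)) h',
      mem_J2_of_mem (ZFSet.mem_pair.2 (.inr rfl)) h'⟩
  · rintro ⟨ha, hb⟩
    have : IotaRud fun v => ZFSet.pair (v 0) (v 1) := inferInstance
    exact this.mem_J2 (v := fun n => if n = 0 then a else b) fun i => by
      split_ifs <;> assumption

/-- Subclasses of `J₂` given by rudimentary relations. -/
def IsRudClass (X : Set ZFSet.{0}) : Prop :=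
  ∃ P : ZFSet.{0} → Prop, IotaFun P ∧ ∀ x, x ∈ X ↔ x ∈ J2 ∧ P x

namespace IsRudClass

variable {X Y : Set ZFSet.{0}}

theorem isIotaClass (hX : IsRudClass X) : IsIotaClass X := by
  obtain ⟨P, hP, h⟩ := hX
  exact hP.isIotaClass h

theorem sep (hX : IsRudClass X) {Q : ZFSet.{0} → Prop} (hQ : IotaFun Q) :
    IsRudClass {x ∈ X | Q x} := by
  obtain ⟨P, hP, h⟩ := hX
  exact ⟨fun x => P x ∧ Q x, by fun_prop, fun x => by simp [h, and_assoc]⟩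

theorem prod (hX : IsRudClass X) (hY : IsRudClass Y) : IsRudClass (classProd X Y) := by
  obtain ⟨P, hP, h⟩ := hX
  obtain ⟨Q, hQ, h'⟩ := hY
  refine ⟨fun z => (P (rudFst z) ∧ Q (rudSnd z)) ∧ z = ZFSet.pair (rudFst z) (rudSnd z),
    by fun_prop, fun z => ⟨?_, ?_⟩⟩
  · rintro ⟨a, ha, b, hb, rfl⟩
    rw [h] at ha
    rw [h'] at hb
    simp [pair_mem_J2_iff, *]
  · rintro ⟨hz, ⟨ha, hb⟩, hab⟩
    rw [hab, pair_mem_J2_iff] at hz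
    exact ⟨_, (h _).2 ⟨hz.1, ha⟩, _, (h' _).2 ⟨hz.2, hb⟩, hab⟩

theorem graph (hX : IsRudClass X) {F G : ZFSet.{0} → ZFSet.{0}} (hG : IotaFun G)
    (hFG : ∀ x ∈ X, F x = G x) : IsRudClass (graph X F) := by
  obtain ⟨P, hP, h⟩ := hX
  refine ⟨fun z => P (rudFst z) ∧ z = ZFSet.pair (rudFst z) (G (rudFst z)), by fun_prop,
    fun z => ⟨?_, ?_⟩⟩
  · rintro ⟨a, ha, rfl⟩
    rw [hFG a ha]
    rw [h] at ha
    have : G a ∈ J2 := hG.mem_J2 (a := a) ha.1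
    simp [pair_mem_J2_iff, *]
  · rintro ⟨hz, ha, hab⟩
    rw [hab, pair_mem_J2_iff] at hz
    have := (h _).2 ⟨hz.1, ha⟩
    exact ⟨_, this, by rw [hFG _ this]; exact hab⟩

/-- Agreement with a rudimentary `G` on `X` suffices, so the projections `fst` and `snd`, defined by
choice, can be exchanged for rudimentary ones. The set of values of `G` on `x` bounds the image. -/
theorem isIotaFunction (hX : IsRudClass X) (hY : IsRudClass Y) {F G : ZFSet.{0} → ZFSet.{0}}
    (hG : IotaFun G) (hFG : ∀ x ∈ X, F x = G x) (hF : Set.MapsTo F X Y) :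
    IsIotaFunction X Y F where
  domain := hX.isIotaClass
  codomain := hY.isIotaClass
  mapsTo := hF
  graph_class := (hX.graph hG hFG).isIotaClass
  image_bound x hx := by
    have : IotaFun fun x : ZFSet.{0} => replacement x G := by fun_prop
    exact ⟨_, this.mem_J2 (a := x) hx.1, fun a ha =>
      mem_replacement.2 ⟨a, ha, hFG a (hx.2 ha)⟩⟩

end IsRudClass

/-! ## Sets of rational numbers -/

theorem ratSet_eq_codes : ratSet = codes ℚ := by
  ext z
  simp only [ratSet, ZFSet.mem_range, mem_codes]
  rfl

theorem mem_ofRats {x : ZFSet.{0}} {A : Set ℚ} : x ∈ ofRats A ↔ ∃ q ∈ A, x = code q := by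
  simp only [ofRats, ZFSet.mem_range, Subtype.exists]
  exact ⟨fun ⟨q, hq, h⟩ => ⟨q, hq, h.symm⟩, fun ⟨q, hq, h⟩ => ⟨q, hq, h.symm⟩⟩

theorem code_mem_ofRats {q : ℚ} {A : Set ℚ} : code q ∈ ofRats A ↔ q ∈ A := by
  rw [mem_ofRats]
  constructor
  · rintro ⟨q', hq', h⟩
    rwa [IotaType.code_injective h]
  · exact fun h => ⟨q, h, rfl⟩

@[simp] theorem toRats_ofRats (A : Set ℚ) : toRats (ofRats A) = A :=
  Set.ext fun _ => code_mem_ofRats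

theorem ofRats_toRats {x : ZFSet.{0}} (hx : x ⊆ ratSet) : ofRats (toRats x) = x := by
  ext z
  rw [mem_ofRats]
  constructor
  · rintro ⟨q, hq, rfl⟩
    exact hq
  · intro hz
    have := hx hz
    rw [ratSet_eq_codes, mem_codes] at this
    obtain ⟨q, rfl⟩ := this
    exact ⟨q, hz, rfl⟩

theorem ofRats_subset_ratSet (A : Set ℚ) : ofRats A ⊆ ratSet := by
  intro z hz
  obtain ⟨q, -, rfl⟩ := mem_ofRats.1 hz
  rw [ratSet_eq_codes]
  exact code_mem_codes q

theorem ofRats_subset_ofRats {A B : Set ℚ} : ofRats A ⊆ ofRats B ↔ A ⊆ B := by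
  constructor
  · exact fun h q hq => code_mem_ofRats.1 (h (code_mem_ofRats.2 hq))
  · intro h z hz
    obtain ⟨q, hq, rfl⟩ := mem_ofRats.1 hz
    exact code_mem_ofRats.2 (h hq)

instance : IotaType (Set ℚ) := ⟨ofRats, Function.LeftInverse.injective toRats_ofRats⟩

@[simp] theorem code_setRat (A : Set ℚ) : code A = ofRats A := rfl

section

variable {α : Type*} [IotaType α]

/-- A set of rationals is separated from the ι-set of all rationals by its membership relation. All
operations on cuts are treated in this way. -/
protected theorem IotaFun.of_mem {f : α → Set ℚ} (hf : IotaFun fun p : α × ℚ => p.2 ∈ f p.1) :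
    IotaFun f := by
  obtain ⟨P, hP⟩ : ∃ P : α → ℚ → Prop, ∀ a q, P a q ↔ q ∈ f a := ⟨_, fun _ _ => Iff.rfl⟩
  simp only [← hP] at hf
  refine (by fun_prop : IotaFun fun a => (codes ℚ).sep fun x => ∃ q : ℚ, x = code q ∧ P a q).congr
    (g := fun a => code (f a)) fun a => ?_
  ext z
  rw [code_setRat, mem_ofRats, ZFSet.mem_sep]
  constructor
  · rintro ⟨q, hq, rfl⟩
    exact ⟨code_mem_codes q, q, rfl, (hP _ _).2 hq⟩
  · rintro ⟨-, q, rfl, hq⟩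
    exact ⟨q, (hP _ _).1 hq, rfl⟩

@[fun_prop]
protected theorem IotaFun.mem_setRat {f : α → Set ℚ} {g : α → ℚ} (hf : IotaFun f)
    (hg : IotaFun g) : IotaFun (fun a => g a ∈ f a) :=
  (by fun_prop : IotaFun fun a => code (g a) ∈ code (f a)).congr fun a =>
    propext code_mem_ofRats.symm

@[fun_prop]
protected theorem IotaFun.toRats {f : α → ZFSet.{0}} (hf : IotaFun f) :
    IotaFun (fun a => toRats (f a)) :=
  .of_mem (by fun_prop : IotaFun fun p : α × ℚ => code p.2 ∈ f p.1)

@[fun_prop]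
protected theorem IotaFun.ofRats {f : α → Set ℚ} (hf : IotaFun f) :
    IotaFun (fun a => ofRats (f a)) := hf

@[fun_prop]
protected theorem IotaFun.cutAdd {f g : α → Set ℚ} (hf : IotaFun f) (hg : IotaFun g) :
    IotaFun (fun a => cutAdd (f a) (g a)) :=
  .of_mem (by fun_prop : IotaFun fun p : α × ℚ =>
    ∃ a, a ∈ f p.1 ∧ ∃ b, b ∈ g p.1 ∧ p.2 = a + b)

@[fun_prop]
protected theorem IotaFun.cutNeg {f : α → Set ℚ} (hf : IotaFun f) :
    IotaFun (fun a => cutNeg (f a)) :=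
  .of_mem (by fun_prop : IotaFun fun p : α × ℚ => ∃ r, ¬ r ∈ f p.1 ∧ p.2 < - r)

@[fun_prop]
protected theorem IotaFun.cutMulNonneg {f g : α → Set ℚ} (hf : IotaFun f) (hg : IotaFun g) :
    IotaFun (fun a => cutMulNonneg (f a) (g a)) :=
  .of_mem (by fun_prop : IotaFun fun p : α × ℚ =>
    p.2 < 0 ∨ ∃ a, a ∈ f p.1 ∧ ∃ b, b ∈ g p.1 ∧ 0 ≤ a ∧ 0 ≤ b ∧ p.2 = a * b)

open Classical in
@[fun_prop]
protected theorem IotaFun.ite_setRat {P : α → Prop} {f g : α → Set ℚ} (hP : IotaFun P)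
    (hf : IotaFun f) (hg : IotaFun g) : IotaFun (fun a => if P a then f a else g a) :=
  .of_mem <| (by fun_prop : IotaFun fun p : α × ℚ =>
    (P p.1 ∧ p.2 ∈ f p.1) ∨ (¬ P p.1 ∧ p.2 ∈ g p.1)).congr fun p => by
      by_cases h : P p.1 <;> simp [h]

@[fun_prop]
protected theorem IotaFun.cutZero_subset {f : α → Set ℚ} (hf : IotaFun f) :
    IotaFun (fun a => cutZero ⊆ f a) :=
  (by fun_prop : IotaFun fun a => ∀ q : ℚ, q < 0 → q ∈ f a)

@[fun_prop]
protected theorem IotaFun.cutMul {f g : α → Set ℚ} (hf : IotaFun f) (hg : IotaFun g) :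
    IotaFun (fun a => cutMul (f a) (g a)) := by
  unfold cutMul
  fun_prop

@[fun_prop]
protected theorem IotaFun.add {f g : α → ZFSet.{0}} (hf : IotaFun f) (hg : IotaFun g) :
    IotaFun (fun a => add (f a) (g a)) := by
  unfold add
  fun_prop

@[fun_prop]
protected theorem IotaFun.mul {f g : α → ZFSet.{0}} (hf : IotaFun f) (hg : IotaFun g) :
    IotaFun (fun a => mul (f a) (g a)) := by
  unfold mul
  fun_prop

@[fun_prop]
protected theorem IotaFun.isCut {f : α → Set ℚ} (hf : IotaFun f) :
    IotaFun (fun a => IsCut (f a)) :=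
  (by fun_prop : IotaFun fun a => (∃ q : ℚ, q ∈ f a) ∧ (∃ q : ℚ, ¬ q ∈ f a) ∧
    (¬ ∃ q : ℚ, q ∈ f a ∧ ∀ b, b ∈ f a → b ≤ q) ∧
      ∀ q : ℚ, q ∈ f a → ∀ b : ℚ, b < q → b ∈ f a).congr fun a => by
    rw [IsCut, ← Set.nonempty_iff_ne_empty, Set.ne_univ_iff_exists_notMem]
    rfl

end

theorem isRudClass_RIota : IsRudClass RIota :=
  ⟨fun x => x ⊆ codes ℚ ∧ IsCut (toRats x), by fun_prop, fun x => by
    rw [← ratSet_eq_codes, ← and_assoc]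
    rfl⟩

/-! ## Cuts and real numbers -/

/-- The lower cut of a real number. -/
def lowerCut (r : ℝ) : Set ℚ := {q | (q : ℝ) < r}

@[simp] theorem mem_lowerCut {r : ℝ} {q : ℚ} : q ∈ lowerCut r ↔ (q : ℝ) < r := Iff.rfl

theorem lowerCut_subset_lowerCut {r s : ℝ} : lowerCut r ⊆ lowerCut s ↔ r ≤ s := by
  constructor
  · intro h
    by_contra! hrs
    obtain ⟨q, hq, hq'⟩ := exists_rat_btwn hrs
    exact lt_asymm hq (h hq')
  · exact fun h q hq => lt_of_lt_of_le hq h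

theorem lowerCut_injective : Function.Injective lowerCut := fun _ _ h =>
  le_antisymm (lowerCut_subset_lowerCut.1 h.subset) (lowerCut_subset_lowerCut.1 h.superset)

theorem isCut_lowerCut (r : ℝ) : IsCut (lowerCut r) := by
  refine ⟨?_, ?_, ?_, fun a ha b hb => ?_⟩
  · obtain ⟨q, hq⟩ := exists_rat_lt r
    exact Set.nonempty_iff_ne_empty.1 ⟨q, hq⟩
  · obtain ⟨q, hq⟩ := exists_rat_gt r
    exact (Set.ne_univ_iff_exists_notMem _).2 ⟨q, fun h => lt_asymm hq h⟩
  · rintro ⟨a, ha, h⟩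
    obtain ⟨q, hq, hq'⟩ := exists_rat_btwn (mem_lowerCut.1 ha)
    exact absurd (h hq') (not_le.2 (by exact_mod_cast hq))
  · exact lt_trans (by exact_mod_cast hb) (mem_lowerCut.1 ha)

/-- The real number is the supremum; that the cut has no greatest element makes its members strictly
smaller. -/
theorem IsCut.exists_eq_lowerCut {A : Set ℚ} (hA : IsCut A) : ∃ r, A = lowerCut r := by
  obtain ⟨h₁, h₂, h₃, h₄⟩ := hA
  rw [← Set.nonempty_iff_ne_empty] at h₁
  obtain ⟨p, hp⟩ := (Set.ne_univ_iff_exists_notMem _).1 h₂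
  have hub : ∀ q ∈ A, q < p := fun q hq => by
    by_contra! h
    rcases h.eq_or_lt with rfl | h
    · exact hp hq
    · exact hp (h₄ q hq p h)
  have hbdd : BddAbove ((fun q : ℚ => (q : ℝ)) '' A) :=
    ⟨p, by
      rintro _ ⟨q, hq, rfl⟩
      exact Rat.cast_le.2 (hub q hq).le⟩
  refine ⟨sSup ((fun q : ℚ => (q : ℝ)) '' A), Set.ext fun q => ⟨fun hq => ?_, fun hq => ?_⟩⟩
  · have : ∃ q' ∈ A, q < q' := by
      by_contra! h
      exact h₃ ⟨q, hq, h⟩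
    obtain ⟨q', hq', hlt⟩ := this
    have hlt' : (q : ℝ) < q' := by exact_mod_cast hlt
    exact lt_of_lt_of_le hlt' (le_csSup hbdd ⟨q', hq', rfl⟩)
  · obtain ⟨_, ⟨q', hq', rfl⟩, hlt⟩ := exists_lt_of_lt_csSup (h₁.image _) (mem_lowerCut.1 hq)
    exact h₄ q' hq' q (Rat.cast_lt.1 hlt)

theorem cutZero_subset_lowerCut {r : ℝ} : cutZero ⊆ lowerCut r ↔ 0 ≤ r := by
  have : cutZero = lowerCut 0 := by ext; simp [cutZero]
  rw [this, lowerCut_subset_lowerCut]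

theorem cutAdd_lowerCut (r s : ℝ) : cutAdd (lowerCut r) (lowerCut s) = lowerCut (r + s) := by
  ext q
  constructor
  · rintro ⟨a, ha, b, hb, rfl⟩
    rw [mem_lowerCut] at *
    push_cast
    exact add_lt_add ha hb
  · intro hq
    rw [mem_lowerCut] at hq
    obtain ⟨a, ha, ha'⟩ := exists_rat_btwn (show (q : ℝ) - s < r by linarith)
    refine ⟨a, ha', q - a, ?_, by ring⟩
    rw [mem_lowerCut]
    push_cast
    linarith

theorem cutNeg_lowerCut (r : ℝ) : cutNeg (lowerCut r) = lowerCut (-r) := by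
  ext q
  constructor
  · rintro ⟨p, hp, hq⟩
    rw [mem_lowerCut, not_lt] at hp
    have : (q : ℝ) < -p := by exact_mod_cast hq
    rw [mem_lowerCut]
    linarith
  · intro hq
    rw [mem_lowerCut] at hq
    obtain ⟨p, hp, hp'⟩ := exists_rat_btwn (show r < -(q : ℝ) by linarith)
    refine ⟨p, fun h => lt_asymm hp h, ?_⟩
    have : (q : ℝ) < ((-p : ℚ) : ℝ) := by push_cast; linarith
    exact_mod_cast this

theorem cutMulNonneg_lowerCut {r s : ℝ} (hr : 0 ≤ r) (hs : 0 ≤ s) :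
    cutMulNonneg (lowerCut r) (lowerCut s) = lowerCut (r * s) := by
  ext q
  constructor
  · rintro (hq | ⟨a, ha, b, hb, ha0, hb0, rfl⟩)
    · have : (q : ℝ) < 0 := by exact_mod_cast hq
      exact lt_of_lt_of_le this (mul_nonneg hr hs)
    · rw [mem_lowerCut] at *
      push_cast
      exact mul_lt_mul'' ha hb (by exact_mod_cast ha0) (by exact_mod_cast hb0)
  · intro hq
    rw [mem_lowerCut] at hq
    rcases lt_or_ge q 0 with hq0 | hq0
    · exact .inl hq0
    · have hq0' : (0 : ℝ) ≤ q := by exact_mod_cast hq0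
      have hrs : 0 < r * s := lt_of_le_of_lt hq0' hq
      have hs' : 0 < s := lt_of_le_of_ne hs fun h => by simp [← h] at hrs
      -- With `a` strictly between `q / s` and `r`, the cofactor `q / a` is less than `s`.
      obtain ⟨a, ha, ha'⟩ := exists_rat_btwn ((div_lt_iff₀ hs').2 hq)
      have ha0 : (0 : ℝ) < a := lt_of_le_of_lt (div_nonneg hq0' hs) ha
      have ha0' : 0 < a := by exact_mod_cast ha0
      refine .inr ⟨a, ha', q / a, ?_, ha0'.le, div_nonneg hq0 ha0'.le, by field_simp⟩
      rw [mem_lowerCut]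
      push_cast
      rw [div_lt_iff₀ ha0, mul_comm]
      exact (div_lt_iff₀ hs').1 ha

theorem cutMul_lowerCut (r s : ℝ) : cutMul (lowerCut r) (lowerCut s) = lowerCut (r * s) := by
  unfold cutMul
  simp only [cutZero_subset_lowerCut, cutNeg_lowerCut]
  split_ifs with hr hs hs
  · exact cutMulNonneg_lowerCut hr hs
  · rw [cutMulNonneg_lowerCut hr (by linarith), cutNeg_lowerCut]
    congr 1; ring
  · rw [cutMulNonneg_lowerCut (by linarith) hs, cutNeg_lowerCut]
    congr 1; ring
  · rw [cutMulNonneg_lowerCut (by linarith) (by linarith)]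
    congr 1; ring

/-- The reciprocal of a positive cut. -/
def cutInv (A : Set ℚ) : Set ℚ := {q | ∃ p, p ∉ A ∧ p * q < 1}

theorem cutInv_lowerCut {r : ℝ} (hr : 0 < r) : cutInv (lowerCut r) = lowerCut r⁻¹ := by
  ext q
  constructor
  · rintro ⟨p, hp, hpq⟩
    rw [mem_lowerCut, not_lt] at hp
    have hpq' : (p : ℝ) * q < 1 := by exact_mod_cast hpq
    rw [mem_lowerCut, inv_eq_one_div, lt_div_iff₀ hr]
    rcases le_or_gt (q : ℝ) 0 with h | h
    · nlinarith
    · nlinarith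
  · intro hq
    rw [mem_lowerCut] at hq
    -- For `q ≤ 0` any `p` above `r` works; otherwise `p` is taken between `r` and `1 / q`.
    have : ∃ p : ℚ, r < p ∧ (p : ℝ) * q < 1 := by
      rcases le_or_gt (q : ℝ) 0 with h | h
      · obtain ⟨p, hp⟩ := exists_rat_gt r
        exact ⟨p, hp, by nlinarith⟩
      · obtain ⟨p, hp, hp'⟩ := exists_rat_btwn ((lt_inv_comm₀ h hr).1 hq)
        refine ⟨p, hp, ?_⟩
        rwa [inv_eq_one_div, lt_div_iff₀ h] at hp'
    obtain ⟨p, hp, hpq⟩ := this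
    exact ⟨p, fun h => lt_asymm hp h, by exact_mod_cast hpq⟩

/-! ### The ι-real line as a subfield of ℝ -/

/-- A real number as a set of rational numbers. -/
def realCode (r : ℝ) : ZFSet.{0} := ofRats (lowerCut r)

theorem realCode_injective : Function.Injective realCode := fun _ _ h =>
  lowerCut_injective (IotaType.code_injective (α := Set ℚ) h)

theorem realCode_subset_realCode {r s : ℝ} : realCode r ⊆ realCode s ↔ r ≤ s :=
  ofRats_subset_ofRats.trans lowerCut_subset_lowerCut

theorem mem_RIota {x : ZFSet.{0}} : x ∈ RIota ↔ x ∈ J2 ∧ ∃ r, x = realCode r := by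
  constructor
  · rintro ⟨⟨hx, hx'⟩, hcut⟩
    obtain ⟨r, hr⟩ := hcut.exists_eq_lowerCut
    exact ⟨hx, r, by rw [realCode, ← hr, ofRats_toRats hx']⟩
  · rintro ⟨hx, r, rfl⟩
    refine ⟨⟨hx, ofRats_subset_ratSet _⟩, ?_⟩
    rw [realCode, toRats_ofRats]
    exact isCut_lowerCut r

theorem add_realCode (r s : ℝ) : add (realCode r) (realCode s) = realCode (r + s) := by
  simp only [add, realCode, toRats_ofRats, cutAdd_lowerCut]

theorem mul_realCode (r s : ℝ) : mul (realCode r) (realCode s) = realCode (r * s) := by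
  simp only [mul, realCode, toRats_ofRats, cutMul_lowerCut]

theorem realCode_ratCast_mem_J2 (q : ℚ) : realCode q ∈ J2 := by
  have h : IotaFun fun q : ℚ => {p : ℚ | p < q} :=
    .of_mem (by fun_prop : IotaFun fun p : ℚ × ℚ => p.2 < p.1)
  have : lowerCut q = {p : ℚ | p < q} := by ext p; simp
  rw [realCode, this]
  exact h.mem_J2 (mem_J2_of_mem (code_mem_codes q) codes_mem_J2)

theorem realCode_neg_mem_J2 {r : ℝ} (hr : realCode r ∈ J2) : realCode (-r) ∈ J2 := by
  have h : IotaFun fun A : Set ℚ => cutNeg A := by fun_prop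
  have := h.mem_J2 (a := lowerCut r) hr
  rwa [cutNeg_lowerCut] at this

theorem realCode_inv_mem_J2 {r : ℝ} (hr : realCode r ∈ J2) : realCode r⁻¹ ∈ J2 := by
  have key : ∀ {r : ℝ}, 0 < r → realCode r ∈ J2 → realCode r⁻¹ ∈ J2 := fun {r} h0 hr => by
    have h : IotaFun fun A : Set ℚ => cutInv A :=
      .of_mem (by fun_prop : IotaFun fun p : Set ℚ × ℚ => ∃ q : ℚ, ¬ q ∈ p.1 ∧ q * p.2 < 1)
    have := h.mem_J2 (a := lowerCut r) hr
    rwa [cutInv_lowerCut h0] at this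
  rcases lt_trichotomy r 0 with h | rfl | h
  · have := realCode_neg_mem_J2 (key (neg_pos.2 h) (realCode_neg_mem_J2 hr))
    rwa [inv_neg, neg_neg] at this
  · rwa [inv_zero]
  · exact key h hr

/-- The real numbers whose cuts are ι-sets. -/
def iotaReals : Subfield ℝ where
  carrier := {r | realCode r ∈ J2}
  mul_mem' {r s} hr hs := by
    have h : IotaFun fun p : ZFSet.{0} × ZFSet.{0} => mul p.1 p.2 := by fun_prop
    have := h.mem_J2 (a := (realCode r, realCode s)) (pair_mem_J2_iff.2 ⟨hr, hs⟩)
    rwa [code_ZFSet, mul_realCode] at this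
  one_mem' := by simpa using realCode_ratCast_mem_J2 1
  add_mem' {r s} hr hs := by
    have h : IotaFun fun p : ZFSet.{0} × ZFSet.{0} => add p.1 p.2 := by fun_prop
    have := h.mem_J2 (a := (realCode r, realCode s)) (pair_mem_J2_iff.2 ⟨hr, hs⟩)
    rwa [code_ZFSet, add_realCode] at this
  zero_mem' := by simpa using realCode_ratCast_mem_J2 0
  neg_mem' {_} hr := realCode_neg_mem_J2 hr
  inv_mem' _ hr := realCode_inv_mem_J2 hr

/-- The ι-real line is the field of real numbers whose cuts are ι-sets. -/
def equivRIota : RIota ≃ iotaReals :=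
  (Equiv.ofBijective (fun r : iotaReals => (⟨realCode r, mem_RIota.2 ⟨r.2, r, rfl⟩⟩ : RIota))
    ⟨fun r s h => Subtype.ext (realCode_injective (congrArg Subtype.val h)), fun ⟨x, hx⟩ => by
      obtain ⟨hx', r, rfl⟩ := mem_RIota.1 hx
      exact ⟨⟨r, hx'⟩, rfl⟩⟩).symm

/-- The real number given by an element of the ι-real line. -/
def toReal (a : RIota) : ℝ := equivRIota a

@[simp] theorem realCode_toReal (a : RIota) : realCode (toReal a) = a :=
  congrArg Subtype.val (equivRIota.symm_apply_apply a)

theorem toReal_le_toReal {a b : RIota} : toReal a ≤ toReal b ↔ a ≤ b := by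
  rw [← realCode_subset_realCode, realCode_toReal, realCode_toReal]
  rfl

/-- The field axioms are transported from `iotaReals`; `coe_add_RIota` and `coe_mul_RIota` identify
the transported operations with those on cuts. -/
instance : Field RIota := equivRIota.field

/-- The embedding of the ι-real line into the real line. -/
def toRealHom : RIota →+* ℝ := iotaReals.subtype.comp equivRIota.ringEquiv.toRingHom

@[simp] theorem toRealHom_apply (a : RIota) : toRealHom a = toReal a := rfl

theorem coe_add_RIota (a b : RIota) : ((a + b : RIota) : ZFSet.{0}) = add a b := by
  rw [← realCode_toReal (a + b), ← realCode_toReal a, ← realCode_toReal b, add_realCode]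
  exact congrArg realCode (map_add toRealHom a b)

theorem coe_mul_RIota (a b : RIota) : ((a * b : RIota) : ZFSet.{0}) = mul a b := by
  rw [← realCode_toReal (a * b), ← realCode_toReal a, ← realCode_toReal b, mul_realCode]
  exact congrArg realCode (map_mul toRealHom a b)

/-! ## The operations and the order as ι-classes -/

theorem fst_pair (a b : ZFSet.{0}) : fst (ZFSet.pair a b) = a := by
  have h : ∃ a' b', ZFSet.pair a b = ZFSet.pair a' b' := ⟨a, b, rfl⟩
  rw [fst, dif_pos h]
  obtain ⟨b', hb⟩ := h.choose_spec
  exact (ZFSet.pair_inj.1 hb).1.symm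

theorem snd_pair (a b : ZFSet.{0}) : snd (ZFSet.pair a b) = b := by
  have h : ∃ b' a', ZFSet.pair a b = ZFSet.pair a' b' := ⟨b, a, rfl⟩
  rw [snd, dif_pos h]
  obtain ⟨b', hb⟩ := h.choose_spec
  exact (ZFSet.pair_inj.1 hb).2.symm

theorem isIotaFunction_RIota_prod {op : ZFSet.{0} → ZFSet.{0} → ZFSet.{0}}
    (hop : IotaFun fun p : ZFSet.{0} × ZFSet.{0} => op p.1 p.2)
    (h : ∀ a b : RIota, op a b ∈ RIota) :
    IsIotaFunction (classProd RIota RIota) RIota (fun p => op (fst p) (snd p)) := by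
  refine (isRudClass_RIota.prod isRudClass_RIota).isIotaFunction isRudClass_RIota
    (G := fun p => op (rudFst p) (rudSnd p))
    (hop.comp (g := fun p => (rudFst p, rudSnd p)) (by fun_prop)) ?_ ?_
  · rintro _ ⟨a, -, b, -, rfl⟩
    simp [fst_pair, snd_pair]
  · rintro _ ⟨a, ha, b, hb, rfl⟩
    simpa [fst_pair, snd_pair] using h ⟨a, ha⟩ ⟨b, hb⟩

theorem isIotaFunction_add :
    IsIotaFunction (classProd RIota RIota) RIota (fun p => add (fst p) (snd p)) :=
  isIotaFunction_RIota_prod (by fun_prop) fun a b => coe_add_RIota a b ▸ (a + b).2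

theorem isIotaFunction_mul :
    IsIotaFunction (classProd RIota RIota) RIota (fun p => mul (fst p) (snd p)) :=
  isIotaFunction_RIota_prod (by fun_prop) fun a b => coe_mul_RIota a b ▸ (a * b).2

theorem isIotaRelation_leRel : IsIotaRelation RIota leRel := by
  refine ⟨isRudClass_RIota.isIotaClass, ?_, ?_⟩
  · have h : leRel = {z ∈ classProd RIota RIota | rudFst z ⊆ rudSnd z} := by
      ext z
      constructor
      · rintro ⟨a, b, hab, rfl⟩
        exact ⟨⟨a, a.2, b, b.2, rfl⟩, by simpa using hab⟩
      · rintro ⟨⟨a, ha, b, hb, rfl⟩, h⟩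
        exact ⟨⟨a, ha⟩, ⟨b, hb⟩, by simpa using h, rfl⟩
    rw [h]
    exact ((isRudClass_RIota.prod isRudClass_RIota).sep (by fun_prop)).isIotaClass
  · rintro _ ⟨a, b, -, rfl⟩
    exact ⟨a, a.2, b, b.2, rfl⟩

/-! ## Least upper bounds -/

theorem code_mem_realCode {q : ℚ} {r : ℝ} : code q ∈ realCode r ↔ (q : ℝ) < r :=
  code_mem_ofRats

theorem mem_coe_RIota {a : RIota} {z : ZFSet.{0}} :
    z ∈ (a : ZFSet.{0}) ↔ ∃ q : ℚ, (q : ℝ) < toReal a ∧ z = code q := by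
  rw [← realCode_toReal a, realCode, mem_ofRats]
  simp

theorem code_mem_coe_RIota {a : RIota} {q : ℚ} :
    code q ∈ (a : ZFSet.{0}) ↔ (q : ℝ) < toReal a := by
  rw [← realCode_toReal a, code_mem_realCode]

theorem realCode_ratCast_mem_RIota (q : ℚ) : realCode q ∈ RIota :=
  mem_RIota.2 ⟨realCode_ratCast_mem_J2 q, q, rfl⟩

/-- An upper bound in `RIota` can be replaced by a rational that belongs to no member of `x`. The
quantifier over the class `RIota` thus becomes one over the ι-set of rationals. -/
theorem mem_boundedSubsets {x : ZFSet.{0}} : x ∈ boundedSubsets ↔ x ∈ J2 ∧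
    (∀ y ∈ x, y ∈ RIota) ∧ (∃ y, y ∈ x) ∧ ∃ q : ℚ, code q ∉ ZFSet.sUnion x := by
  constructor
  · rintro ⟨⟨hx, hsub⟩, ⟨a, ha⟩, ⟨b, hb⟩⟩
    refine ⟨hx, hsub, ⟨a, ha⟩, ?_⟩
    obtain ⟨q, hq⟩ := exists_rat_gt (toReal b)
    refine ⟨q, fun h => ?_⟩
    obtain ⟨y, hy, hqy⟩ := ZFSet.mem_sUnion.1 h
    have hyb : (⟨y, hsub hy⟩ : RIota) ≤ b := hb hy
    have hqy := code_mem_coe_RIota (a := ⟨y, hsub hy⟩).1 hqy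
    exact lt_asymm hq (hqy.trans_le (toReal_le_toReal.2 hyb))
  · rintro ⟨hx, hsub, ⟨y, hy⟩, q, hq⟩
    refine ⟨⟨hx, hsub⟩, ⟨⟨y, hsub y hy⟩, hy⟩, ⟨realCode q, realCode_ratCast_mem_RIota q⟩,
      fun a ha => ?_⟩
    change (a : ZFSet.{0}) ⊆ realCode q
    rw [← realCode_toReal a, realCode_subset_realCode]
    by_contra! h
    refine hq (ZFSet.mem_sUnion.2 ⟨a, ha, ?_⟩)
    exact code_mem_coe_RIota.2 h

/-- The union of the cuts is the lower cut of the supremum in ℝ, and it is an ι-set since the union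
is rudimentary. -/
theorem isLUB_sUnion {x : ZFSet.{0}} (hx : x ∈ boundedSubsets) :
    ∃ s : RIota, ZFSet.sUnion x = s ∧ IsLUB (realsIn x) s := by
  obtain ⟨⟨hJ, hsub⟩, hne, ⟨b, hb⟩⟩ := hx
  have hbdd : BddAbove (toReal '' realsIn x) :=
    ⟨toReal b, by rintro _ ⟨a, ha, rfl⟩; exact toReal_le_toReal.2 (hb ha)⟩
  have hU : ZFSet.sUnion x = realCode (sSup (toReal '' realsIn x)) := by
    ext z
    rw [realCode, mem_ofRats, ZFSet.mem_sUnion]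
    constructor
    · rintro ⟨y, hy, hz⟩
      obtain ⟨q, hq, rfl⟩ := mem_coe_RIota (a := ⟨y, hsub hy⟩).1 hz
      exact ⟨q, lt_of_lt_of_le hq (le_csSup hbdd ⟨⟨y, hsub hy⟩, hy, rfl⟩), rfl⟩
    · rintro ⟨q, hq, rfl⟩
      obtain ⟨_, ⟨a, ha, rfl⟩, hqa⟩ := exists_lt_of_lt_csSup (hne.image _) (mem_lowerCut.1 hq)
      exact ⟨a, ha, code_mem_coe_RIota.2 hqa⟩
  have hUJ : ZFSet.sUnion x ∈ J2 :=
    (by fun_prop : IotaFun fun x : ZFSet.{0} => ZFSet.sUnion x).mem_J2 (a := x) hJ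
  refine ⟨⟨ZFSet.sUnion x, mem_RIota.2 ⟨hUJ, _, hU⟩⟩, rfl, fun a ha z hz =>
    ZFSet.mem_sUnion.2 ⟨a, ha, hz⟩, fun c hc z hz => ?_⟩
  obtain ⟨y, hy, hz⟩ := ZFSet.mem_sUnion.1 hz
  exact (show (⟨y, hsub hy⟩ : RIota) ≤ c from hc hy) hz

theorem isRudClass_boundedSubsets : IsRudClass boundedSubsets := by
  obtain ⟨P, hP, h⟩ := isRudClass_RIota
  refine ⟨fun x => (¬ ∃ y ∈ x, ¬ P y) ∧ (∃ y ∈ x, True) ∧ ∃ q : ℚ, ¬ code q ∈ ZFSet.sUnion x,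
    by fun_prop, fun x => ?_⟩
  rw [mem_boundedSubsets]
  simp only [and_true]
  push Not
  refine and_congr_right fun hx => and_congr_left fun _ => forall₂_congr fun y hy => ?_
  rw [h]
  exact and_iff_right (mem_J2_of_mem hy hx)

theorem isIotaFunction_sUnion : IsIotaFunction boundedSubsets RIota ZFSet.sUnion :=
  isRudClass_boundedSubsets.isIotaFunction isRudClass_RIota (G := ZFSet.sUnion) (by fun_prop)
    (fun _ _ => rfl) fun x hx => by
      obtain ⟨s, hs, -⟩ := isLUB_sUnion hx
      rw [hs]
      exact s.2

/-! ## Generated subfields -/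

/-- A set of real numbers which contains `1` and is closed under subtraction and reciprocals of
positive elements is a subfield. -/
def subfieldOfSubInv (W : Set ℝ) (h1 : 1 ∈ W) (hsub : ∀ a ∈ W, ∀ b ∈ W, a - b ∈ W)
    (hinv : ∀ a ∈ W, 0 < a → a⁻¹ ∈ W) : Subfield ℝ :=
  have h0 : (0 : ℝ) ∈ W := by simpa using hsub 1 h1 1 h1
  have hneg : ∀ a ∈ W, -a ∈ W := fun a ha => by simpa using hsub 0 h0 a ha
  have hadd : ∀ a ∈ W, ∀ b ∈ W, a + b ∈ W := fun a ha b hb => by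
    simpa using hsub a ha (-b) (hneg b hb)
  have hinv' : ∀ a ∈ W, a⁻¹ ∈ W := fun a ha => by
    rcases lt_trichotomy a 0 with h | rfl | h
    · simpa [inv_neg] using hneg _ (hinv _ (hneg a ha) (neg_pos.2 h))
    · simpa using h0
    · exact hinv a ha h
  have hhalf : ∀ a ∈ W, a / 2 ∈ W := fun a ha => by
    have := hinv' _ (hadd _ (hinv' a ha) _ (hinv' a ha))
    rwa [← two_mul, mul_inv, inv_inv, mul_comm, ← div_eq_mul_inv] at this
  have hsq : ∀ a ∈ W, a * a ∈ W := fun a ha => by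
    by_cases h : a = 0
    · simpa [h] using h0
    by_cases h' : a + 1 = 0
    · rw [eq_neg_of_add_eq_zero_left h']
      simpa using h1
    -- Squares come from `a² = (a⁻¹ - (a + 1)⁻¹)⁻¹ - a`, valid for `a ≠ 0, -1`; products then follow
    -- by polarization, with halving as `(a⁻¹ + a⁻¹)⁻¹`.
    have := hsub _ (hinv' _ (hsub _ (hinv' a ha) _ (hinv' _ (hadd a ha 1 h1)))) a ha
    convert this using 1
    have : a⁻¹ - (a + 1)⁻¹ = (a * (a + 1))⁻¹ := by field_simp; ring
    rw [this, inv_inv]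
    ring
  { carrier := W
    mul_mem' := fun {a b} ha hb => by
      have := hhalf _ (hsub _ (hsub _ (hsq _ (hadd a ha b hb)) _ (hsq a ha)) _ (hsq b hb))
      convert this using 1
      ring
    one_mem' := h1
    add_mem' := fun {a b} ha hb => hadd a ha b hb
    zero_mem' := h0
    neg_mem' := fun {a} ha => hneg a ha
    inv_mem' := hinv' }

/-- A coded type with a set of codes is a rudimentary image of `J₁`. -/
theorem exists_surjective_iotaFun (γ : Type*) [IotaType γ] [IotaSetType γ] [Inhabited γ] :
    ∃ f : J1 → γ, IotaFun f ∧ Function.Surjective f := by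
  classical
  obtain ⟨g, hg, h⟩ := exists_cover (codes_mem_J2 (γ := γ))
  let f : J1 → γ := fun s => if h : ∃ c : γ, code c = g s then h.choose else default
  -- Values of the cover that code nothing are sent to `default`. Although `f` uses choice, codes
  -- are injective and its graph is therefore rudimentary.
  have hf : ∀ s c, f s = c ↔ code c = g s ∨ (¬ ∃ c : γ, code c = g s) ∧ c = default := by
    intro s c
    by_cases hs : ∃ c : γ, code c = g s
    · simp only [f, dif_pos hs, hs, not_true, false_and, or_false]
      exact ⟨fun h => h ▸ hs.choose_spec,
        fun h => IotaType.code_injective (hs.choose_spec.trans h.symm)⟩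
    · have : ¬ code c = g s := fun h => hs ⟨c, h⟩
      simp only [f, dif_neg hs, hs, this, not_false_eq_true, true_and, false_or]
      exact eq_comm
  refine ⟨f, .of_graph ?_, fun c => ?_⟩
  · simp only [hf]
    fun_prop
  · obtain ⟨s, hs⟩ := h _ (code_mem_codes c)
    exact ⟨s, (hf s c).2 (.inl hs)⟩

/-- The natural number `n` as an element of `J₁`. -/
def tag (n : ℕ) : J1 := ⟨code n, code_nat_mem_J1 n⟩

@[simp] theorem tag_inj {m n : ℕ} : tag m = tag n ↔ m = n :=
  Subtype.ext_iff.trans IotaType.code_injective.eq_iff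

@[simp] theorem pairJ1_inj {s t s' t' : J1} :
    pairJ1 s t = pairJ1 s' t' ↔ s = s' ∧ t = t' :=
  Subtype.ext_iff.trans
    (ZFSet.pair_inj.trans (and_congr Subtype.ext_iff.symm Subtype.ext_iff.symm))

theorem rank_left_lt (s t : J1) : ZFSet.rank s < ZFSet.rank (pairJ1 s t) :=
  (ZFSet.rank_lt_of_mem (ZFSet.mem_singleton.2 rfl)).trans
    (ZFSet.rank_lt_of_mem (ZFSet.mem_pair.2 (.inl rfl) : {(s : ZFSet.{0})} ∈ ZFSet.pair s t))

theorem rank_right_lt (s t : J1) : ZFSet.rank t < ZFSet.rank (pairJ1 s t) :=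
  (ZFSet.rank_lt_of_mem (ZFSet.mem_pair.2 (.inr rfl))).trans
    (ZFSet.rank_lt_of_mem
      (ZFSet.mem_pair.2 (.inr rfl) : {(s : ZFSet.{0}), (t : ZFSet.{0})} ∈ ZFSet.pair s t))

/-! Codes of field terms: generators, differences and reciprocals. -/

/-- The term for the generator with index `s`. -/
def genTerm (s : J1) : J1 := pairJ1 (tag 0) s

/-- The difference of two terms. -/
def subTerm (s t : J1) : J1 := pairJ1 (tag 1) (pairJ1 s t)

/-- The reciprocal of a term. -/
def invTerm (s : J1) : J1 := pairJ1 (tag 2) s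

section

variable {α : Type*} [IotaType α]

@[fun_prop]
protected theorem IotaFun.genTerm {f : α → J1} (hf : IotaFun f) :
    IotaFun (fun a => genTerm (f a)) := by
  unfold genTerm; fun_prop

@[fun_prop]
protected theorem IotaFun.subTerm {f g : α → J1} (hf : IotaFun f) (hg : IotaFun g) :
    IotaFun (fun a => subTerm (f a) (g a)) := by
  unfold subTerm; fun_prop

@[fun_prop]
protected theorem IotaFun.invTerm {f : α → J1} (hf : IotaFun f) :
    IotaFun (fun a => invTerm (f a)) := by
  unfold invTerm; fun_prop

end

/-! ### Derivations of rational bounds for the values of field terms -/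

section

variable (D : J1 → Prop) (C : J1 → Set ℚ) (rat : J1 → ℚ)

/-- The term `t` has the value `a`, where the generator with index `s` is defined if `D s` and has
the lower cut `C s`. -/
inductive HasValue : J1 → ℝ → Prop
  | gen (s : J1) (a : ℝ) : D s → C s = lowerCut a → HasValue (genTerm s) a
  | sub (s t : J1) (a b : ℝ) : HasValue s a → HasValue t b → HasValue (subTerm s t) (a - b)
  -- Reciprocals are restricted to positive values because positivity is witnessed by a positive
  -- rational lower bound.
  | inv (s : J1) (a : ℝ) : 0 < a → HasValue s a → HasValue (invTerm s) a⁻¹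

/-- The statement that the value of the term `t` lies between `rat l` and `rat u`. -/
def bounds (t l u : J1) : J1 := pairJ1 t (pairJ1 l u)

/-- Bounds for the value of `t` which follow from bounds for its subterms in `c`. -/
def Justified (c t l u : J1) : Prop :=
  (∃ s, t = genTerm s ∧ D s ∧ rat l ∈ C s ∧ ¬ rat u ∈ C s) ∨
  -- Interval subtraction: `l ≤ l₁ - u₂` and `u₁ - l₂ ≤ u`. Rationals are infinite blocks, so a
  -- derivation mentions them only through their indices in `J1`.
  (∃ s s' l₁ u₁ l₂ u₂ : J1, t = subTerm s s' ∧ (bounds s l₁ u₁ : ZFSet.{0}) ∈ (c : ZFSet.{0}) ∧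
    (bounds s' l₂ u₂ : ZFSet.{0}) ∈ (c : ZFSet.{0}) ∧ rat l + rat u₂ ≤ rat l₁ ∧
    rat u₁ ≤ rat u + rat l₂) ∨
  (∃ s l₁ u₁ : J1, t = invTerm s ∧ (bounds s l₁ u₁ : ZFSet.{0}) ∈ (c : ZFSet.{0}) ∧
    0 < rat l₁ ∧ rat l * rat u₁ ≤ 1 ∧ 1 ≤ rat u * rat l₁)

/-- Sets of bounds each of which is justified by bounds in the set. -/
def IsDerivation (c : J1) : Prop :=
  ∀ t l u : J1, (bounds t l u : ZFSet.{0}) ∈ (c : ZFSet.{0}) → Justified D C rat c t l u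

/-- The set of rational numbers which derivably are less than the value of `t`. -/
def derivedCut (t : J1) : Set ℚ :=
  {q | ∃ c l u : J1, IsDerivation D C rat c ∧ (bounds t l u : ZFSet.{0}) ∈ (c : ZFSet.{0}) ∧
    q < rat l}

variable {D C rat}

/-- Derivations, terms and indices of rationals are all elements of `J1`, so every quantifier
involved is bounded by an ι-set. -/
theorem iotaFun_derivedCut (hD : IotaFun D) (hC : IotaFun C) (hrat : IotaFun rat) :
    IotaFun (derivedCut D C rat) := by
  refine .of_mem ?_
  unfold derivedCut IsDerivation Justified bounds
  simp only [Set.mem_ofPred_eq]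
  fun_prop

/-- Soundness of derivations, by induction on the evaluation: the tag of the term leaves one
possible kind of justification, and interval arithmetic does the rest. -/
theorem HasValue.bounds_le {t : J1} {a : ℝ} (ha : HasValue D C t a) {c : J1}
    (hc : IsDerivation D C rat c) {l u : J1} (h : (bounds t l u : ZFSet.{0}) ∈ (c : ZFSet.{0})) :
    rat l ≤ a ∧ a ≤ rat u := by
  induction ha generalizing l u with
  | gen s a hD hs =>
    rcases hc _ _ _ h with ⟨s', hs', -, hl, hu⟩ | ⟨s', _, _, _, _, _, hs', -⟩ | ⟨s', _, _, hs', -⟩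
    · obtain rfl : s = s' := by simpa [genTerm] using hs'
      rw [hs, mem_lowerCut] at hl hu
      exact ⟨hl.le, not_lt.1 hu⟩
    · simp [genTerm, subTerm] at hs'
    · simp [genTerm, invTerm] at hs'
  | sub s t a b _ _ iha ihb =>
    rcases hc _ _ _ h with ⟨s', hs', -⟩ | ⟨s', t', l₁, u₁, l₂, u₂, hs', h₁, h₂, hl, hu⟩ |
      ⟨s', _, _, hs', -⟩
    · simp [genTerm, subTerm] at hs'
    · obtain ⟨rfl, rfl⟩ : s = s' ∧ t = t' := by simpa [subTerm] using hs'
      obtain ⟨hl₁, hu₁⟩ := iha h₁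
      obtain ⟨hl₂, hu₂⟩ := ihb h₂
      have hl' : (rat l : ℝ) + rat u₂ ≤ rat l₁ := by exact_mod_cast hl
      have hu' : (rat u₁ : ℝ) ≤ rat u + rat l₂ := by exact_mod_cast hu
      constructor <;> linarith
    · simp [subTerm, invTerm] at hs'
  | inv s a ha _ ih =>
    rcases hc _ _ _ h with ⟨s', hs', -⟩ | ⟨s', _, _, _, _, _, hs', -⟩ |
      ⟨s', l₁, u₁, hs', h₁, hpos, hl, hu⟩
    · simp [genTerm, invTerm] at hs'
    · simp [subTerm, invTerm] at hs'
    · obtain rfl : s = s' := by simpa [invTerm] using hs'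
      obtain ⟨hl₁, hu₁⟩ := ih h₁
      have hpos' : (0 : ℝ) < rat l₁ := by exact_mod_cast hpos
      have hl' : (rat l : ℝ) * rat u₁ ≤ 1 := by exact_mod_cast hl
      have hu' : (1 : ℝ) ≤ rat u * rat l₁ := by exact_mod_cast hu
      rw [inv_eq_one_div, le_div_iff₀ ha, div_le_iff₀ ha]
      constructor
      · rcases le_or_gt (rat l : ℝ) 0 with h | h <;> nlinarith
      · have : (0 : ℝ) < rat u := by
          by_contra! h
          nlinarith
        nlinarith

/-- Subterms have smaller rank than the term. For a reciprocal, soundness turns the derived positive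
lower bound into positivity of the value. -/
theorem IsDerivation.exists_hasValue (hD : ∀ s, D s → ∃ a, C s = lowerCut a) {c : J1}
    (hc : IsDerivation D C rat c) (t : J1) :
    ∀ l u : J1, (bounds t l u : ZFSet.{0}) ∈ (c : ZFSet.{0}) → ∃ a, HasValue D C t a := by
  induction t using WellFounded.induction
    (InvImage.wf (fun t : J1 => ZFSet.rank t) Ordinal.lt_wf) with | _ t ih =>
  intro l u h
  rcases hc _ _ _ h with ⟨s, rfl, hs, -⟩ | ⟨s, s', l₁, u₁, l₂, u₂, rfl, h₁, h₂, -⟩ |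
    ⟨s, l₁, u₁, rfl, h₁, hpos, -⟩
  · obtain ⟨a, ha⟩ := hD s hs
    exact ⟨a, .gen s a hs ha⟩
  · obtain ⟨a, ha⟩ := ih s ((rank_left_lt _ _).trans (rank_right_lt _ _)) _ _ h₁
    obtain ⟨b, hb⟩ := ih s' ((rank_right_lt _ _).trans (rank_right_lt _ _)) _ _ h₂
    exact ⟨_, .sub s s' a b ha hb⟩
  · obtain ⟨a, ha⟩ := ih s (rank_right_lt _ _) _ _ h₁
    refine ⟨_, .inv s a (lt_of_lt_of_le ?_ (ha.bounds_le hc h₁).1) ha⟩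
    exact_mod_cast hpos

theorem Justified.mono {c c' t l u : J1} (h : Justified D C rat c t l u)
    (hcc : (c : ZFSet.{0}) ⊆ c') : Justified D C rat c' t l u := by
  rcases h with h | ⟨s, s', l₁, u₁, l₂, u₂, ht, h₁, h₂, h⟩ | ⟨s, l₁, u₁, ht, h₁, h⟩
  · exact .inl h
  · exact .inr (.inl ⟨s, s', l₁, u₁, l₂, u₂, ht, hcc h₁, hcc h₂, h⟩)
  · exact .inr (.inr ⟨s, l₁, u₁, ht, hcc h₁, h⟩)

theorem IsDerivation.exists_union {c c' : J1} (hc : IsDerivation D C rat c)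
    (hc' : IsDerivation D C rat c') : ∃ d : J1, IsDerivation D C rat d ∧
      (c : ZFSet.{0}) ⊆ d ∧ (c' : ZFSet.{0}) ⊆ d := by
  have h₁ : (c : ZFSet.{0}) ⊆ (c : ZFSet.{0}) ∪ c' := fun z hz => ZFSet.mem_union.2 (.inl hz)
  have h₂ : (c' : ZFSet.{0}) ⊆ (c : ZFSet.{0}) ∪ c' := fun z hz => ZFSet.mem_union.2 (.inr hz)
  refine ⟨⟨_, union_mem_J1 c.2 c'.2⟩, fun t l u h => ?_, h₁, h₂⟩
  rcases ZFSet.mem_union.1 h with h | h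
  · exact (hc t l u h).mono h₁
  · exact (hc' t l u h).mono h₂

theorem IsDerivation.exists_insert {c t l u : J1} (hc : IsDerivation D C rat c)
    (h : Justified D C rat c t l u) :
    ∃ d : J1, IsDerivation D C rat d ∧ (bounds t l u : ZFSet.{0}) ∈ (d : ZFSet.{0}) := by
  have h₁ : (c : ZFSet.{0}) ⊆ insert (bounds t l u : ZFSet.{0}) (c : ZFSet.{0}) :=
    fun z hz => ZFSet.mem_insert_of_mem _ hz
  refine ⟨⟨_, insert_mem_J1 (bounds t l u).2 c.2⟩, fun t' l' u' h' => ?_, ZFSet.mem_insert _ _⟩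
  rcases ZFSet.mem_insert_iff.1 h' with h' | h'
  · obtain ⟨rfl, rfl, rfl⟩ : t' = t ∧ l' = l ∧ u' = u := by
      simpa [bounds] using Subtype.ext h'
    exact h.mono h₁
  · exact (hc _ _ _ h').mono h₁

/-- Completeness of derivations: arbitrarily tight bounds for a term follow from sufficiently tight
bounds for its subterms, and finitely many bounds can be collected in an element of `J1`. -/
theorem HasValue.exists_derivation (hrat : Function.Surjective rat) {t : J1} {a : ℝ}
    (ha : HasValue D C t a) {p q : ℚ} (hp : (p : ℝ) < a) (hq : a < q) :
    ∃ c l u : J1, IsDerivation D C rat c ∧ (bounds t l u : ZFSet.{0}) ∈ (c : ZFSet.{0}) ∧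
      rat l = p ∧ rat u = q := by
  induction ha generalizing p q with
  | gen s a hs ha =>
    obtain ⟨l, rfl⟩ := hrat p
    obtain ⟨u, rfl⟩ := hrat q
    have h0 : IsDerivation D C rat ⟨∅, empty_mem_J1⟩ := fun t l u h =>
      (ZFSet.notMem_empty _ h).elim
    obtain ⟨d, hd, h⟩ := h0.exists_insert (t := genTerm s) (l := l) (u := u) (.inl ⟨s, rfl, hs, by
      rw [ha]; exact ⟨hp, fun h => lt_asymm hq h⟩⟩)
    exact ⟨d, l, u, hd, h, rfl, rfl⟩
  | sub s s' a b _ _ iha ihb =>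
    obtain ⟨l, rfl⟩ := hrat p
    obtain ⟨u, rfl⟩ := hrat q
    -- The bounds `p₁ < a < q₁` are chosen so that `q₁ - u < b < p₁ - l`; these outer terms are then
    -- the bounds to be derived for the subtrahend.
    obtain ⟨p₁, hp₁, hp₁'⟩ := exists_rat_btwn (show (rat l : ℝ) + b < a by linarith)
    obtain ⟨q₁, hq₁, hq₁'⟩ := exists_rat_btwn (show a < (rat u : ℝ) + b by linarith)
    obtain ⟨c, l₁, u₁, hc, h₁, rfl, rfl⟩ := iha hp₁' hq₁
    obtain ⟨c', l₂, u₂, hc', h₂, hl₂, hu₂⟩ := ihb (p := rat u₁ - rat u) (q := rat l₁ - rat l)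
      (by push_cast; linarith) (by push_cast; linarith)
    obtain ⟨d, hd, hcd, hcd'⟩ := hc.exists_union hc'
    obtain ⟨e, he, h⟩ := hd.exists_insert (t := subTerm s s') (l := l) (u := u)
      (.inr (.inl ⟨s, s', l₁, u₁, l₂, u₂, rfl, hcd h₁, hcd' h₂, by linarith, by linarith⟩))
    exact ⟨e, l, u, he, h, rfl, rfl⟩
  | inv s a ha _ ih =>
    obtain ⟨l, rfl⟩ := hrat p
    obtain ⟨u, rfl⟩ := hrat q
    have hu0 : (0 : ℝ) < rat u := (inv_pos.2 ha).trans hq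
    -- Here `p₁` lies between `1 / u` and `a`. The upper bound `q₁` matters only if `l` is positive,
    -- when it is taken below `1 / l`.
    obtain ⟨p₁, hp₁, hp₁'⟩ := exists_rat_btwn ((inv_lt_comm₀ ha hu0).1 hq)
    have hp₁0 : (0 : ℝ) < p₁ := (inv_pos.2 hu0).trans hp₁
    have : ∃ q₁ : ℚ, a < q₁ ∧ (rat l : ℝ) * q₁ ≤ 1 := by
      rcases le_or_gt (rat l : ℝ) 0 with h | h
      · obtain ⟨q₁, hq₁⟩ := exists_rat_gt a
        exact ⟨q₁, hq₁, by nlinarith⟩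
      · obtain ⟨q₁, hq₁, hq₁'⟩ := exists_rat_btwn ((lt_inv_comm₀ h ha).1 hp)
        rw [inv_eq_one_div, lt_div_iff₀ h] at hq₁'
        exact ⟨q₁, hq₁, by linarith⟩
    obtain ⟨q₁, hq₁, hq₁'⟩ := this
    obtain ⟨c, l₁, u₁, hc, h₁, rfl, rfl⟩ := ih hp₁' hq₁
    rw [inv_eq_one_div, div_lt_iff₀ hu0] at hp₁
    have hp₁' : 1 < rat l₁ * rat u := by exact_mod_cast hp₁
    obtain ⟨e, he, h⟩ := hc.exists_insert (t := invTerm s) (l := l) (u := u)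
      (.inr (.inr ⟨s, l₁, u₁, rfl, h₁, by exact_mod_cast hp₁0, by exact_mod_cast hq₁', by
        linarith⟩))
    exact ⟨e, l, u, he, h, rfl, rfl⟩

theorem HasValue.derivedCut_eq (hrat : Function.Surjective rat) {t : J1} {a : ℝ}
    (ha : HasValue D C t a) : derivedCut D C rat t = lowerCut a := by
  ext q
  constructor
  · rintro ⟨c, l, u, hc, h, hq⟩
    have hq' : (q : ℝ) < rat l := by exact_mod_cast hq
    exact hq'.trans_le (ha.bounds_le hc h).1
  · intro hq
    obtain ⟨p, hp, hp'⟩ := exists_rat_btwn (mem_lowerCut.1 hq)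
    obtain ⟨p', hp''⟩ := exists_rat_gt a
    obtain ⟨c, l, u, hc, h, rfl, -⟩ := ha.exists_derivation hrat hp' hp''
    exact ⟨c, l, u, hc, h, by exact_mod_cast hp⟩

/-- A term with a nonempty derived cut has a derivable bound and hence a value, so discarding the
empty set discards exactly the terms without value. -/
theorem exists_hasValue_iff (hD : ∀ s, D s → ∃ a, C s = lowerCut a)
    (hrat : Function.Surjective rat) {t : J1} {A : Set ℚ} :
    derivedCut D C rat t = A ∧ A ≠ ∅ ↔ ∃ a, HasValue D C t a ∧ A = lowerCut a := by
  constructor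
  · rintro ⟨rfl, h⟩
    obtain ⟨q, c, l, u, hc, hb, -⟩ := Set.nonempty_iff_ne_empty.2 h
    obtain ⟨a, ha⟩ := hc.exists_hasValue hD t l u hb
    exact ⟨a, ha, ha.derivedCut_eq hrat⟩
  · rintro ⟨a, ha, rfl⟩
    exact ⟨ha.derivedCut_eq hrat, (isCut_lowerCut a).1⟩

/-- The values of terms are closed under subtraction and reciprocals of positive elements; by
`subfieldOfSubInv` they form a subfield once `1` is among the generators. -/
theorem hasValue_iff_mem_closure (h1 : ∃ s, D s ∧ C s = lowerCut 1) {a : ℝ} :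
    (∃ t, HasValue D C t a) ↔ a ∈ Subfield.closure {a | ∃ s, D s ∧ C s = lowerCut a} := by
  constructor
  · rintro ⟨t, ht⟩
    induction ht with
    | gen s a hs ha => exact Subfield.subset_closure ⟨s, hs, ha⟩
    | sub s t a b _ _ iha ihb => exact sub_mem iha ihb
    | inv s a _ _ iha => exact inv_mem iha
  · obtain ⟨s, hs, hs1⟩ := h1
    let W := subfieldOfSubInv {a | ∃ t, HasValue D C t a} ⟨_, .gen s 1 hs hs1⟩
      (fun a ⟨t, ht⟩ b ⟨t', ht'⟩ => ⟨_, .sub t t' a b ht ht'⟩)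
      (fun a ⟨t, ht⟩ h => ⟨_, .inv t a h ht⟩)
    have : Subfield.closure {a | ∃ s, D s ∧ C s = lowerCut a} ≤ W :=
      Subfield.closure_le.2 fun a ⟨s, hs, ha⟩ => ⟨_, .gen s a hs ha⟩
    exact fun h => this h

end

/-! ### The generated subfield as an ι-set -/

theorem ofRats_eq_empty {A : Set ℚ} : ofRats A = ∅ ↔ A = ∅ := by
  have h : ofRats ∅ = ∅ := by
    ext z
    simp [mem_ofRats]
  rw [← h]
  exact (IotaType.code_injective (α := Set ℚ)).eq_iff

theorem toRats_coe_RIota (a : RIota) : toRats a = lowerCut (toReal a) :=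
  Set.ext fun _ => code_mem_coe_RIota

theorem exists_iotaSet_closure_of_one_mem {x : ZFSet.{0}} (hx : IsIotaSubset x RIota)
    (h1 : realCode 1 ∈ x) : ∃ s : ZFSet.{0}, IsIotaSet s ∧
      (s : Set ZFSet.{0}) = Subtype.val '' (Subfield.closure (realsIn x) : Set RIota) := by
  obtain ⟨hxJ, hsub⟩ := hx
  obtain ⟨h, hh, hcov⟩ := exists_cover hxJ
  obtain ⟨rat, hrat, hsurj⟩ := exists_surjective_iotaFun ℚ
  have hconst : IotaFun fun _ : J1 => x := .const_of_mem hxJ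
  -- The cover `h` may take values outside `x`; `D` admits only the indices of actual generators.
  let D : J1 → Prop := fun s => h s ∈ x
  let C : J1 → Set ℚ := fun s => toRats (h s)
  have hD : IotaFun D := by fun_prop
  have hC : IotaFun C := by fun_prop
  have hDC : ∀ s, D s → ∃ a, C s = lowerCut a := fun s hs => (hsub hs).2.exists_eq_lowerCut
  have hgen : {a | ∃ s, D s ∧ C s = lowerCut a} = toRealHom '' realsIn x := by
    ext a
    constructor
    · rintro ⟨s, hs, ha⟩
      refine ⟨⟨h s, hsub hs⟩, hs, lowerCut_injective ?_⟩
      rw [toRealHom_apply, ← toRats_coe_RIota, ← ha]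
    · rintro ⟨a, ha, rfl⟩
      obtain ⟨s, hs⟩ := hcov a ha
      refine ⟨s, show h s ∈ x from hs ▸ ha, ?_⟩
      rw [toRealHom_apply, ← toRats_coe_RIota, hs]
  obtain ⟨r, hr, hr'⟩ := (iotaFun_derivedCut hD hC hrat).exists_range
  have hdiff : IotaFun fun z : ZFSet.{0} => z \ {∅} := by fun_prop
  refine ⟨r \ {∅}, hdiff.mem_J2 (a := r) hr, ?_⟩
  ext z
  rw [SetLike.mem_coe, ZFSet.mem_sdiff, hr', ZFSet.mem_singleton]
  have h1' : ∃ s, D s ∧ C s = lowerCut 1 := by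
    obtain ⟨s, hs⟩ := hcov _ h1
    exact ⟨s, show h s ∈ x from hs ▸ h1, by simp only [C, ← hs, realCode, toRats_ofRats]⟩
  constructor
  · rintro ⟨⟨t, rfl⟩, ht⟩
    obtain ⟨a, ha, hA⟩ := (exists_hasValue_iff hDC hsurj (t := t)).1
      ⟨rfl, fun h => ht (ofRats_eq_empty.2 h)⟩
    have := (hasValue_iff_mem_closure h1').1 ⟨t, ha⟩
    rw [hgen, ← RingHom.map_field_closure] at this
    obtain ⟨b, hb, rfl⟩ := this
    exact ⟨b, hb, by rw [hA, ← realCode_toReal b]; rfl⟩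
  · rintro ⟨b, hb, rfl⟩
    have : toRealHom b ∈ (Subfield.closure (realsIn x)).map toRealHom := ⟨b, hb, rfl⟩
    rw [RingHom.map_field_closure, ← hgen, ← hasValue_iff_mem_closure h1'] at this
    obtain ⟨t, ht⟩ := this
    obtain ⟨h₁, h₂⟩ := (exists_hasValue_iff hDC hsurj (t := t)).2 ⟨_, ht, rfl⟩
    rw [← realCode_toReal b]
    exact ⟨⟨t, by rw [h₁]; rfl⟩, fun h => h₂ (ofRats_eq_empty.1 h)⟩

/-- Adjoining `1` to the generators leaves the subfield unchanged, and it also takes care of empty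
`x`. -/
theorem exists_iotaSet_closure {x : ZFSet.{0}} (hx : IsIotaSubset x RIota) :
    ∃ s : ZFSet.{0}, IsIotaSet s ∧
      (s : Set ZFSet.{0}) = Subtype.val '' (Subfield.closure (realsIn x) : Set RIota) := by
  have h1 : ((1 : RIota) : ZFSet.{0}) = realCode 1 := by
    rw [← realCode_toReal]
    exact congrArg realCode (map_one toRealHom)
  have hins : IotaFun fun p : ZFSet.{0} × ZFSet.{0} => insert p.1 p.2 := by fun_prop
  obtain ⟨s, hs, h⟩ := exists_iotaSet_closure_of_one_mem (x := insert (realCode 1) x)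
    ⟨hins.mem_J2 (a := (realCode 1, x)) (pair_mem_J2_iff.2
      ⟨h1 ▸ (mem_RIota.1 (1 : RIota).2).1, hx.1⟩), fun y hy => by
        rcases ZFSet.mem_insert_iff.1 hy with rfl | hy
        · exact h1 ▸ (1 : RIota).2
        · exact hx.2 hy⟩ (ZFSet.mem_insert _ _)
  refine ⟨s, hs, h.trans ?_⟩
  congr 2
  refine le_antisymm (Subfield.closure_le.2 fun a ha => ?_) (Subfield.closure_mono fun a ha =>
    ZFSet.mem_insert_of_mem _ ha)
  rcases ZFSet.mem_insert_iff.1 ha with ha | ha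
  · rw [← h1] at ha
    rw [Subtype.ext ha]
    exact one_mem _
  · exact Subfield.subset_closure ha

end IotaAnalysis

end

open IotaAnalysis in
theorem theorem3p2 :
    -- the ι-real line is an ι-class
    IsIotaClass RIota ∧
    -- addition and multiplication are ι-functions
    IsIotaFunction (classProd RIota RIota) RIota (fun p => add (fst p) (snd p)) ∧
    IsIotaFunction (classProd RIota RIota) RIota (fun p => mul (fst p) (snd p)) ∧
    -- the order is an ι-relation
    IsIotaRelation RIota leRel ∧
    -- these operations make the ι-real line a field, in which the subfield generated by any
    -- ι-subset is an ι-set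
    (∃ _ : Field RIota,
      (∀ a b : RIota, ((a + b : RIota) : ZFSet.{0}) = add a b) ∧
      (∀ a b : RIota, ((a * b : RIota) : ZFSet.{0}) = mul a b) ∧
      ∀ x : ZFSet.{0}, IsIotaSubset x RIota →
        ∃ s : ZFSet.{0}, IsIotaSet s ∧
          (s : Set ZFSet.{0}) = Subtype.val '' (Subfield.closure (realsIn x) : Set RIota)) ∧
    -- every nonempty ι-subset that is bounded above has a least upper bound
    (∀ x ∈ boundedSubsets, ∃ s : RIota, IsLUB (realsIn x) s) ∧
    -- the map taking each such subset to its least upper bound is an ι-function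
    (∃ F : ZFSet.{0} → ZFSet.{0},
      (∀ x ∈ boundedSubsets, ∃ s : RIota, F x = s ∧ IsLUB (realsIn x) s) ∧
      IsIotaFunction boundedSubsets RIota F) :=
  ⟨isRudClass_RIota.isIotaClass, isIotaFunction_add, isIotaFunction_mul, isIotaRelation_leRel,
    ⟨inferInstance, coe_add_RIota, coe_mul_RIota, fun _ hx => exists_iotaSet_closure hx⟩,
    fun _ hx => (isLUB_sUnion hx).imp fun _ h => h.2,
    ZFSet.sUnion, fun _ hx => isLUB_sUnion hx, isIotaFunction_sUnion⟩
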